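/- Work in the Euclidean plane. For $\theta\in\mathbb R$ let $u_\theta=(\cos\theta,\sin\theta)$. For a planar convex body $C$ (a single point is allowed), let $\ell_\theta(C)$ be the normal line of $C$: the line with direction $u_\theta$ through the point of $C$ lying on the supporting line of $C$ that is orthogonal to $u_\theta$ and for which $u_\theta$ points into the half-plane containing $C$ (it is unique for all but countably many $\theta$, and for every $\theta$ if $C$ is a point or strictly convex, in particular if $C$ has constant width). For convex bodies $C_1,C_2$ put $$\operatorname{pdist}(C_1,C_2)=\frac12\int_0^{2\pi}\operatorname{dist}\bigl(\ell_\theta(C_1),\ell_\theta(C_2)\bigr)\,d\theta ,$$ where $\operatorname{dist}$ is the Euclidean distance between parallel lines, and for convex bodies $C,D$ put $$\operatorname{pper}_D(C)=\frac12\int_0^{2\pi}\Bigl(\operatorname{dist}\bigl(\ell^r_\theta(C),\ell_\theta(D)\bigr)+\operatorname{dist}\bigl(\ell^l_\theta(C),\ell_\theta(D)\bigr)\Bigr)\,d\theta ,$$ where $\ell^r_\theta(C)$ and $\ell^l_\theta(C)$ are the two supporting lines of $C$ parallel to $\ell_\theta(D)$. Let $D$ be a planar body of constant width, that is, a nonempty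 compact convex set having the same width in every direction, and let $P\subseteq D$ be a convex polygon with vertices $a_1,\dots,a_m$, $m\ge 3$. Degenerate polygons are allowed: it is only required that $P$ is the convex hull of $a_1,\dots,a_m$ and that every $a_i$ lies on the boundary of $P$, so straight angles and coinciding vertices (counted with multiplicity) may occur, and $P$ may be a segment or a point. Then $$\sum_{i=1}^m \operatorname{pdist}(a_i,D)\le \operatorname{pper}_D(P)+(m-2)\operatorname{diam}(D).$$ -/

import Mathlib

/-- The Euclidean plane. -/
abbrev Plane : Type := EuclideanSpace ℝ (Fin 2)

noncomputable section

/-- The unit vector `u_θ`, obtained by rotating `u_0 = (1, 0)` counterclockwise by `θ`. -/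
def unitVec (θ : ℝ) : Plane := !₂[Real.cos θ, Real.sin θ]

/-- The unit vector `v_θ`, obtained by rotating `u_θ` clockwise by `π / 2`. -/
def tangentVec (θ : ℝ) : Plane := !₂[Real.sin θ, -Real.cos θ]

/-- The common points of `C` and its supporting line that is orthogonal to `u_θ` and for which
`u_θ` points into the half-plane containing `C`: the points of `C` at which `u_θ` is an inward
normal vector. -/
def supportPoints (C : Set Plane) (θ : ℝ) : Set Plane :=
  {p | p ∈ C ∧ ∀ y ∈ C, inner ℝ (unitVec θ) p ≤ inner ℝ (unitVec θ) y}

/-- The normal line `ℓ_θ(C)`: the line in direction `u_θ` through the support point of `C` with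
inward normal `u_θ`. When that support point is unique (for every `θ` if `C` is a point or strictly
convex, for all but countably many `θ` if `C` is any planar convex body) this is a line; in the
remaining exceptional directions it is the union of all the candidate lines. -/
def normalLine (C : Set Plane) (θ : ℝ) : Set Plane :=
  {x | ∃ p ∈ supportPoints C θ, ∃ t : ℝ, x = p + t • unitVec θ}

/-- One of the two supporting lines of `C` in direction `u_θ`: the one on the side of `v_θ`. -/
def rightSupportLine (C : Set Plane) (θ : ℝ) : Set Plane :=
  {x | inner ℝ (tangentVec θ) x = sSup ((fun y => inner ℝ (tangentVec θ) y) '' C)}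

/-- The other supporting line of `C` in direction `u_θ`: the one on the side of `-v_θ`. -/
def leftSupportLine (C : Set Plane) (θ : ℝ) : Set Plane :=
  {x | inner ℝ (tangentVec θ) x = sInf ((fun y => inner ℝ (tangentVec θ) y) '' C)}

/-- The Euclidean distance between two sets, `inf {|x - y| : x ∈ A, y ∈ B}`; it is only used for
parallel lines. -/
def lineDist (A B : Set Plane) : ℝ := sInf (Set.image2 dist A B)

/-- The pseudodistance
`pdist(C₁, C₂) = (1/2) ∫_0^{2π} dist(ℓ_θ(C₁), ℓ_θ(C₂)) dθ`. -/
def pdist (C₁ C₂ : Set Plane) : ℝ :=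
  (1 / 2) * ∫ θ in (0 : ℝ)..(2 * Real.pi), lineDist (normalLine C₁ θ) (normalLine C₂ θ)

/-- The generalized perimeter
`pper_D(C) = (1/2) ∫_0^{2π} (dist(ℓ_θ^r(C), ℓ_θ(D)) + dist(ℓ_θ^l(C), ℓ_θ(D))) dθ`. -/
def pper (D C : Set Plane) : ℝ :=
  (1 / 2) * ∫ θ in (0 : ℝ)..(2 * Real.pi),
    (lineDist (rightSupportLine C θ) (normalLine D θ) +
      lineDist (leftSupportLine C θ) (normalLine D θ))

/-- The width of `C` in the direction `u`: for a unit vector `u`, the distance between the two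
supporting lines of `C` orthogonal to `u`. -/
def widthIn (C : Set Plane) (u : Plane) : ℝ :=
  sSup ((fun y => inner ℝ u y) '' C) - sInf ((fun y => inner ℝ u y) '' C)

/-- A planar body of constant width: a nonempty compact convex set that has the same width in all
directions (a single point, of constant width `0`, is included). -/
structure IsConstantWidthBody (D : Set Plane) : Prop where
  convex : Convex ℝ D
  isCompact : IsCompact D
  nonempty : D.Nonempty
  constWidth : ∃ w : ℝ, ∀ u : Plane, ‖u‖ = 1 → widthIn D u = w

/-- `P` is a convex polygon with vertices `a 0, …, a (m - 1)`, with `m ≥ 3`: it is the convex hull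
of the `a i`, all of which lie on its boundary. Degenerate polygons are included: straight angles
and coinciding vertices (counted with multiplicity) are allowed, and `P` may be a segment or a
point. If no `a i` is in the convex hull of the others, this is a polygon in the strict sense. -/
structure IsConvexPolygon {m : ℕ} (P : Set Plane) (a : Fin m → Plane) : Prop where
  three_le : 3 ≤ m
  eq_convexHull : P = convexHull ℝ (Set.range a)
  mem_frontier : ∀ i, a i ∈ frontier P

end

/-! Opposite directions give the same lines, so all integrals run over half a turn. With w the width
of D, the aim is to remove one point at a time at a cost of at most w, until two points remain;
these are outermost in every direction and contribute nothing (`integral_polygon_le`).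

A point in the hull of the others is never needed as an outermost one, so removing it costs its own
pseudodistance. This is at most w (`integral_abs_normalGap_le`): the point lies on a diameter of D,
and for boundary points the value is exactly w. In convex position, a vertex sees all other points
in the cone spanned by two of them (`exists_cone_of_convex_position`), and removing it costs at most
the integral of the distance from the normal line to the middle one of these three points.
Everything thus rests on the triangle case: that integral is at most w (`integral_medianGap_le`).

For the triangle case, D is replaced by an outer parallel body, so that normal gaps of boundary
points have strict signs, and a maximizing triple is taken. If it is degenerate, one point lies
between the others and the bound for a single point applies. Otherwise half a turn splits into three
sectors, the angles of the triangle, in each of which one vertex is the middle point. The first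
variation at a vertex is a linear functional minimized over D at that vertex. Either it vanishes,
and then by convexity the vertex minimizes its sector integral among all points, or the vertex is
the support point in the direction of its angle bisector (`sign_functional_eq_zero_or_bisector`).

Two of the three vertices are of the same kind. If two functionals vanish, both vertices may be
replaced by the third one, which leaves the pseudodistance of a single point. If two vertices are of
bisector kind, the perimeter is at least 2w (`two_mul_width_le`), while the three sector integrals
add up to at most 3w minus the perimeter (`sector_bound`). -/

open Real

/-! ### Coordinates in the frame `(u_θ, v_θ)` -/

/-- The coordinate of `z` along `u_θ`. -/
noncomputable def ncoord (θ : ℝ) (z : Plane) : ℝ := cos θ * z 0 + sin θ * z 1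

/-- The coordinate of `z` along `v_θ`. -/
noncomputable def tcoord (θ : ℝ) (z : Plane) : ℝ := sin θ * z 0 - cos θ * z 1

lemma inner_unitVec (θ : ℝ) (z : Plane) : inner ℝ (unitVec θ) z = ncoord θ z := by
  simp [unitVec, ncoord, PiLp.inner_apply, Fin.sum_univ_two]; ring

lemma inner_tangentVec (θ : ℝ) (z : Plane) : inner ℝ (tangentVec θ) z = tcoord θ z := by
  simp [tangentVec, tcoord, PiLp.inner_apply, Fin.sum_univ_two]; ring

lemma ncoord_add (θ : ℝ) (z z' : Plane) : ncoord θ (z + z') = ncoord θ z + ncoord θ z' := by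
  simp [ncoord]; ring

lemma ncoord_sub (θ : ℝ) (z z' : Plane) : ncoord θ (z - z') = ncoord θ z - ncoord θ z' := by
  simp [ncoord]; ring

lemma ncoord_smul (θ t : ℝ) (z : Plane) : ncoord θ (t • z) = t * ncoord θ z := by
  simp [ncoord]; ring

lemma tcoord_add (θ : ℝ) (z z' : Plane) : tcoord θ (z + z') = tcoord θ z + tcoord θ z' := by
  simp [tcoord]; ring

lemma tcoord_sub (θ : ℝ) (z z' : Plane) : tcoord θ (z - z') = tcoord θ z - tcoord θ z' := by
  simp [tcoord]; ring

lemma tcoord_smul (θ t : ℝ) (z : Plane) : tcoord θ (t • z) = t * tcoord θ z := by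
  simp [tcoord]; ring

lemma isLinearMap_tcoord (θ : ℝ) : IsLinearMap ℝ (tcoord θ) :=
  ⟨tcoord_add θ, fun t z => tcoord_smul θ t z⟩

lemma ncoord_unitVec (θ φ : ℝ) : ncoord θ (unitVec φ) = cos (θ - φ) := by
  simp [ncoord, unitVec, cos_sub]

lemma tcoord_unitVec (θ φ : ℝ) : tcoord θ (unitVec φ) = sin (θ - φ) := by
  simp [tcoord, unitVec, sin_sub]

lemma ncoord_tangentVec (θ φ : ℝ) : ncoord θ (tangentVec φ) = sin (φ - θ) := by
  simp [ncoord, tangentVec, sin_sub]; ring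

lemma ncoord_add_angle (θ t : ℝ) (z : Plane) :
    ncoord (θ + t) z = cos t * ncoord θ z - sin t * tcoord θ z := by
  simp only [ncoord, tcoord, cos_add, sin_add]; ring

lemma tcoord_add_angle (θ t : ℝ) (z : Plane) :
    tcoord (θ + t) z = cos t * tcoord θ z + sin t * ncoord θ z := by
  simp only [ncoord, tcoord, cos_add, sin_add]; ring

lemma ncoord_add_pi (θ : ℝ) (z : Plane) : ncoord (θ + π) z = -ncoord θ z := by
  simp [ncoord_add_angle]

lemma tcoord_add_pi (θ : ℝ) (z : Plane) : tcoord (θ + π) z = -tcoord θ z := by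
  simp [tcoord_add_angle]

/-- Turns support inequalities in two directions into a sign for the tangential coordinate. -/
lemma ncoord_eq_tcoord (τ θ : ℝ) (z : Plane) :
    sin (θ - τ) * tcoord θ z = ncoord τ z - cos (θ - τ) * ncoord θ z := by
  have h1 := ncoord_add_angle τ (θ - τ) z
  have h2 := tcoord_add_angle τ (θ - τ) z
  rw [add_sub_cancel] at h1 h2
  rw [h1, h2]
  linear_combination (-(ncoord τ z)) * (sin_sq_add_cos_sq (θ - τ)) +
    2 * ncoord τ z * (sin_sq_add_cos_sq (θ - τ))

lemma ncoord_sum_angles (α β : ℝ) (z : Plane) :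
    ncoord α z + ncoord β z = 2 * cos ((β - α) / 2) * ncoord ((α + β) / 2) z := by
  have hα : α = (α + β) / 2 + -((β - α) / 2) := by ring
  have hβ : β = (α + β) / 2 + (β - α) / 2 := by ring
  have h1 := ncoord_add_angle ((α + β) / 2) (-((β - α) / 2)) z
  have h2 := ncoord_add_angle ((α + β) / 2) ((β - α) / 2) z
  rw [← hα, cos_neg, sin_neg] at h1
  rw [← hβ] at h2
  rw [h1, h2]; ring

lemma norm_sq_eq_coord (z : Plane) : ‖z‖ ^ 2 = z 0 ^ 2 + z 1 ^ 2 := by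
  simp [EuclideanSpace.norm_sq_eq, Fin.sum_univ_two]

lemma ncoord_sq_add_tcoord_sq (θ : ℝ) (z : Plane) :
    ncoord θ z ^ 2 + tcoord θ z ^ 2 = ‖z‖ ^ 2 := by
  rw [norm_sq_eq_coord]; simp only [ncoord, tcoord]
  linear_combination (z 0 ^ 2 + z 1 ^ 2) * (sin_sq_add_cos_sq θ)

lemma norm_unitVec (θ : ℝ) : ‖unitVec θ‖ = 1 := by
  have h := norm_sq_eq_coord (unitVec θ)
  have h1 : unitVec θ 0 = cos θ := rfl
  have h2 : unitVec θ 1 = sin θ := rfl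
  rw [h1, h2, cos_sq_add_sin_sq] at h
  nlinarith [norm_nonneg (unitVec θ)]

lemma abs_tcoord_le (θ : ℝ) (z : Plane) : |tcoord θ z| ≤ ‖z‖ :=
  abs_le_of_sq_le_sq (by nlinarith [ncoord_sq_add_tcoord_sq θ z, sq_nonneg (ncoord θ z)])
    (norm_nonneg z)

lemma eq_of_coord_eq {θ : ℝ} {z z' : Plane} (h1 : ncoord θ z = ncoord θ z')
    (h2 : tcoord θ z = tcoord θ z') : z = z' := by
  have h := ncoord_sq_add_tcoord_sq θ (z - z')
  rw [ncoord_sub, tcoord_sub, h1, h2] at h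
  have : ‖z - z'‖ = 0 := by nlinarith [norm_nonneg (z - z')]
  exact sub_eq_zero.1 (norm_eq_zero.1 this)

lemma unitVec_add_pi (θ : ℝ) : unitVec (θ + π) = -unitVec θ := by
  ext i; fin_cases i <;> simp [unitVec]

lemma unitVec_add_int_mul (θ : ℝ) (n : ℤ) : unitVec (θ + n * (2 * π)) = unitVec θ := by
  simp [unitVec]

/-- Polar coordinates with the angle in a prescribed period. -/
lemma exists_polar (z : Plane) (hz : z ≠ 0) (base : ℝ) :
    ∃ r θ : ℝ, 0 < r ∧ base < θ ∧ θ ≤ base + 2 * π ∧ z = r • unitVec θ := by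
  set c : ℂ := ⟨z 0, z 1⟩ with hc
  have hc0 : c ≠ 0 := by
    intro h
    apply hz
    ext i
    fin_cases i
    · simpa [hc] using congrArg Complex.re h
    · simpa [hc] using congrArg Complex.im h
  have hz' : z = ‖c‖ • unitVec c.arg := by
    ext i
    fin_cases i
    · simp [unitVec, Complex.norm_mul_cos_arg, hc]
    · simp [unitVec, Complex.norm_mul_sin_arg, hc]
  refine ⟨‖c‖, toIocMod two_pi_pos base c.arg, norm_pos_iff.2 hc0, ?_, ?_, ?_⟩
  · exact left_lt_toIocMod _ _ _
  · exact toIocMod_le_right _ _ _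
  · conv_lhs => rw [hz', ← toIocMod_add_toIocDiv_zsmul two_pi_pos base c.arg, zsmul_eq_mul,
      unitVec_add_int_mul]

lemma continuous_ncoord_comp {X : Type*} [TopologicalSpace X] {f : X → ℝ} {g : X → Plane}
    (hf : Continuous f) (hg : Continuous g) : Continuous fun x => ncoord (f x) (g x) := by
  have h0 : Continuous fun x => (g x) 0 := (continuous_apply 0).comp ((PiLp.continuous_ofLp 2 _).comp hg)
  have h1 : Continuous fun x => (g x) 1 := (continuous_apply 1).comp ((PiLp.continuous_ofLp 2 _).comp hg)
  exact ((continuous_cos.comp hf).mul h0).add ((continuous_sin.comp hf).mul h1)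

lemma continuous_tcoord_comp {X : Type*} [TopologicalSpace X] {f : X → ℝ} {g : X → Plane}
    (hf : Continuous f) (hg : Continuous g) : Continuous fun x => tcoord (f x) (g x) := by
  have h0 : Continuous fun x => (g x) 0 := (continuous_apply 0).comp ((PiLp.continuous_ofLp 2 _).comp hg)
  have h1 : Continuous fun x => (g x) 1 := (continuous_apply 1).comp ((PiLp.continuous_ofLp 2 _).comp hg)
  exact ((continuous_sin.comp hf).mul h0).sub ((continuous_cos.comp hf).mul h1)

lemma hasDerivAt_ncoord (θ : ℝ) (z : Plane) :
    HasDerivAt (fun t => ncoord t z) (-tcoord θ z) θ := by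
  have h := ((hasDerivAt_cos θ).mul_const (z 0)).add ((hasDerivAt_sin θ).mul_const (z 1))
  exact h.congr_deriv (by unfold tcoord; ring)

lemma integral_tcoord (x y : ℝ) (z : Plane) :
    ∫ θ in x..y, tcoord θ z = ncoord x z - ncoord y z := by
  have h := intervalIntegral.integral_eq_sub_of_hasDerivAt (a := x) (b := y)
    (f := fun t => -ncoord t z) (f' := fun θ => tcoord θ z)
    (fun t _ => by simpa using (hasDerivAt_ncoord t z).fun_neg)
    ((continuous_tcoord_comp continuous_id continuous_const).intervalIntegrable _ _)
  rw [h]; ring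

lemma abs_ncoord_sub_le (x y : ℝ) (z : Plane) : |ncoord x z - ncoord y z| ≤ ‖z‖ * |x - y| := by
  rw [← integral_tcoord, abs_sub_comm x y]
  exact intervalIntegral.norm_integral_le_of_norm_le_const
    (f := fun θ => tcoord θ z) fun θ _ => abs_tcoord_le θ z

/-! ### Bodies of constant width through the curve of their support points -/

/-- `p θ` is the point of a body of constant width `w` with inward normal `u_θ`; for `ε > 0`, all
radii of curvature of the body are at least `ε`. -/
structure SupportCurve (p : ℝ → Plane) (w ε : ℝ) : Prop where
  -- Equality holds for a disk of radius ε, where p φ is the center minus ε u_φ.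
  supp : ∀ θ φ, ε * (1 - cos (θ - φ)) ≤ ncoord θ (p φ) - ncoord θ (p θ)
  add_pi : ∀ θ, p (θ + π) = p θ + w • unitVec θ
  continuous : Continuous p
  nonneg : 0 ≤ ε
  width_nonneg : 0 ≤ w

/-- The body bounded by the supporting lines through the points `p θ`. -/
def supportBody (p : ℝ → Plane) : Set Plane := {z | ∀ θ, ncoord θ (p θ) ≤ ncoord θ z}

/-- The distance from `z` to the supporting line with inward normal `u_θ`. -/
noncomputable def supportGap (p : ℝ → Plane) (z : Plane) (θ : ℝ) : ℝ :=
  ncoord θ z - ncoord θ (p θ)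

/-- The signed distance from the line through `z` in direction `u_θ` to the normal line. -/
noncomputable def normalGap (p : ℝ → Plane) (z : Plane) (θ : ℝ) : ℝ :=
  tcoord θ (p θ) - tcoord θ z

lemma supportGap_nonneg {p : ℝ → Plane} {z : Plane} (hz : z ∈ supportBody p) (θ : ℝ) :
    0 ≤ supportGap p z θ :=
  sub_nonneg.2 (hz θ)

lemma supportGap_self (p : ℝ → Plane) (τ : ℝ) : supportGap p (p τ) τ = 0 := sub_self _

lemma convex_supportBody (p : ℝ → Plane) : Convex ℝ (supportBody p) := by
  intro x hx y hy s t hs ht hst θ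
  rw [ncoord_add, ncoord_smul, ncoord_smul]
  have := hx θ; have := hy θ
  calc ncoord θ (p θ) = s * ncoord θ (p θ) + t * ncoord θ (p θ) := by rw [← add_mul, hst, one_mul]
    _ ≤ _ := by gcongr

namespace SupportCurve

variable {p : ℝ → Plane} {w ε : ℝ} (h : SupportCurve p w ε)
include h

lemma le (θ φ : ℝ) : ncoord θ (p θ) ≤ ncoord θ (p φ) := by
  have := h.supp θ φ
  have := mul_nonneg h.nonneg (sub_nonneg.2 (cos_le_one (θ - φ)))
  linarith

lemma mem (φ : ℝ) : p φ ∈ supportBody p := fun θ => h.le θ φ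

lemma gap_add_pi (z : Plane) (θ : ℝ) : supportGap p z (θ + π) = w - supportGap p z θ := by
  simp only [supportGap, ncoord_add_pi, h.add_pi, ncoord_add, ncoord_smul, ncoord_unitVec]
  simp; ring

lemma gap_le {z : Plane} (hz : z ∈ supportBody p) (θ : ℝ) : supportGap p z θ ≤ w := by
  have h1 := supportGap_nonneg hz (θ + π)
  rw [h.gap_add_pi] at h1
  linarith

lemma normalGap_add_pi (z : Plane) (θ : ℝ) : normalGap p z (θ + π) = -normalGap p z θ := by
  simp only [normalGap, tcoord_add_pi, h.add_pi, tcoord_add, tcoord_smul, tcoord_unitVec]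
  simp; ring

lemma continuous_normalGap (z : Plane) : Continuous (normalGap p z) :=
  (continuous_tcoord_comp continuous_id h.continuous).sub
    (continuous_tcoord_comp continuous_id continuous_const)

/-- In the direction of a - b, the length is a difference of two support distances, both in [0, w].
-/
lemma norm_sub_le {a b : Plane} (ha : a ∈ supportBody p) (hb : b ∈ supportBody p) :
    ‖a - b‖ ≤ w := by
  rcases eq_or_ne (a - b) 0 with h0 | h0
  · rw [h0, norm_zero]; exact h.width_nonneg
  · obtain ⟨r, θ, hr, -, -, hab⟩ := exists_polar (a - b) h0 0
    have h1 : ncoord θ (a - b) = r := by rw [hab, ncoord_smul, ncoord_unitVec]; simp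
    have h2 : ‖a - b‖ = r := by rw [hab, norm_smul, norm_unitVec]; simp [abs_of_pos hr]
    have h3 := h.gap_le ha θ
    have h4 := supportGap_nonneg hb θ
    simp only [supportGap] at h3 h4
    rw [ncoord_sub] at h1
    linarith

/-- Strict convexity: `p (θ + π)` is already at normal distance w from a, and the diameter is at
most w, so no tangential offset is left. -/
lemma eq_of_gap_eq_zero {a : Plane} (ha : a ∈ supportBody p) {θ : ℝ}
    (h0 : ncoord θ a = ncoord θ (p θ)) : a = p θ := by
  have h1 := h.norm_sub_le (h.mem (θ + π)) ha
  have h2 := ncoord_sq_add_tcoord_sq θ (p (θ + π) - a)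
  have h3 : ncoord θ (p (θ + π) - a) = w := by
    rw [ncoord_sub, h.add_pi, ncoord_add, ncoord_smul, ncoord_unitVec, h0]; simp
  have h4 : tcoord θ (p (θ + π) - a) = 0 := by
    have h5 := norm_nonneg (p (θ + π) - a)
    have : tcoord θ (p (θ + π) - a) ^ 2 ≤ 0 := by rw [h3] at h2; nlinarith
    exact pow_eq_zero_iff (two_ne_zero) |>.1 (le_antisymm this (sq_nonneg _))
  refine eq_of_coord_eq (θ := θ) h0 ?_
  rw [tcoord_sub, h.add_pi, tcoord_add, tcoord_smul, tcoord_unitVec] at h4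
  simp at h4
  linarith

/-- Envelope argument: replacing `p t` by the fixed point `p θ` changes the value by at most ‖p t -
p θ‖ |t - θ|, which is o(|t - θ|) by continuity of p alone. -/
lemma hasDerivAt_support (θ : ℝ) :
    HasDerivAt (fun t => ncoord t (p t)) (-tcoord θ (p θ)) θ := by
  have hd : HasDerivAt (fun t => ncoord t (p t) - ncoord t (p θ)) 0 θ := by
    rw [hasDerivAt_iff_isLittleO, Asymptotics.isLittleO_iff]
    intro c hc
    obtain ⟨δ, hδ, hball⟩ := Metric.continuous_iff.1 h.continuous θ c hc
    filter_upwards [Metric.ball_mem_nhds θ hδ] with t ht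
    have hpt : ‖p t - p θ‖ ≤ c := by rw [← dist_eq_norm]; exact (hball t ht).le
    have h1 := h.le t θ
    have h2 := h.le θ t
    have h3 := abs_le.1 (abs_ncoord_sub_le t θ (p t - p θ))
    simp only [ncoord_sub] at h3
    have h4 : ‖p t - p θ‖ * |t - θ| ≤ c * |t - θ| :=
      mul_le_mul_of_nonneg_right hpt (abs_nonneg _)
    simp only [sub_self, sub_zero, smul_zero, norm_eq_abs]
    rw [abs_of_nonpos (by linarith)]
    linarith [h3.1]
  exact ((hasDerivAt_ncoord θ (p θ)).add hd).congr_deriv (add_zero _) |>.congr_of_eventuallyEq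
    (Filter.Eventually.of_forall fun t => by simp)

lemma hasDerivAt_gap (z : Plane) (θ : ℝ) : HasDerivAt (supportGap p z) (normalGap p z θ) θ := by
  refine ((hasDerivAt_ncoord θ z).sub (h.hasDerivAt_support θ)).congr_deriv ?_
  simp only [normalGap]; ring

lemma integral_normalGap (z : Plane) (x y : ℝ) :
    ∫ θ in x..y, normalGap p z θ = supportGap p z y - supportGap p z x :=
  intervalIntegral.integral_eq_sub_of_hasDerivAt (fun t _ => h.hasDerivAt_gap z t)
    ((h.continuous_normalGap z).intervalIntegrable _ _)

/-- The support inequalities at τ and θ settle the case of an acute angle. For an obtuse angle the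
same argument uses `p (θ + π)`, which lies on the same normal as `p θ`. -/
lemma normalGap_nonneg {τ θ : ℝ} (h1 : τ < θ) (h2 : θ < τ + π) : 0 ≤ normalGap p (p τ) θ := by
  have hs : 0 < sin (θ - τ) := sin_pos_of_pos_of_lt_pi (by linarith) (by linarith)
  rcases le_total 0 (cos (θ - τ)) with hc | hc
  · have e := ncoord_eq_tcoord τ θ (p θ - p τ)
    rw [tcoord_sub, ncoord_sub, ncoord_sub] at e
    have a1 := h.le τ θ
    have a2 := h.le θ τ
    refine nonneg_of_mul_nonneg_right (a := sin (θ - τ)) ?_ hs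
    unfold normalGap
    rw [e]
    nlinarith
  · have e := ncoord_eq_tcoord τ θ (p (θ + π) - p τ)
    rw [tcoord_sub, ncoord_sub, ncoord_sub] at e
    have a1 := h.le τ (θ + π)
    have a2 := h.le (θ + π) τ
    rw [ncoord_add_pi, ncoord_add_pi] at a2
    have e2 : tcoord θ (p (θ + π)) = tcoord θ (p θ) := by
      rw [h.add_pi, tcoord_add, tcoord_smul, tcoord_unitVec]; simp
    refine nonneg_of_mul_nonneg_right (a := sin (θ - τ)) ?_ hs
    unfold normalGap
    rw [← e2, e]
    nlinarith

/-- The curvature bound ε makes the inequality at τ strict, so the sign of the normal gap is known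
and not merely its weak sign. -/
lemma normalGap_pos (hε : 0 < ε) {τ θ : ℝ} (h1 : τ < θ) (h2 : θ < τ + π) :
    0 < normalGap p (p τ) θ := by
  have hs : 0 < sin (θ - τ) := sin_pos_of_pos_of_lt_pi (by linarith) (by linarith)
  rcases le_total 0 (cos (θ - τ)) with hc | hc
  · have e := ncoord_eq_tcoord τ θ (p θ - p τ)
    rw [tcoord_sub, ncoord_sub, ncoord_sub] at e
    have a1 := h.supp τ θ
    have a2 := h.le θ τ
    have a3 : 0 < ε * (1 - cos (τ - θ)) := mul_pos hε (by
      rw [← neg_sub θ τ, cos_neg]; nlinarith [sin_sq_add_cos_sq (θ - τ), cos_le_one (θ - τ)])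
    refine pos_of_mul_pos_right (a := sin (θ - τ)) ?_ hs.le
    unfold normalGap
    rw [e]
    nlinarith
  · have e := ncoord_eq_tcoord τ θ (p (θ + π) - p τ)
    rw [tcoord_sub, ncoord_sub, ncoord_sub] at e
    have a1 := h.supp τ (θ + π)
    have a2 := h.le (θ + π) τ
    rw [ncoord_add_pi, ncoord_add_pi] at a2
    have e2 : tcoord θ (p (θ + π)) = tcoord θ (p θ) := by
      rw [h.add_pi, tcoord_add, tcoord_smul, tcoord_unitVec]; simp
    have a3 : 0 < ε * (1 - cos (τ - (θ + π))) := mul_pos hε (by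
      rw [← neg_sub (θ + π) τ, cos_neg, show θ + π - τ = θ - τ + π by ring, cos_add_pi]
      nlinarith [sin_sq_add_cos_sq (θ - τ), neg_one_le_cos (θ - τ)])
    refine pos_of_mul_pos_right (a := sin (θ - τ)) ?_ hs.le
    unfold normalGap
    rw [← e2, e]
    nlinarith

lemma normalGap_nonpos {τ θ : ℝ} (h1 : τ - π < θ) (h2 : θ < τ) : normalGap p (p τ) θ ≤ 0 := by
  have h3 := h.normalGap_nonneg (τ := τ) (θ := θ + π) (by linarith) (by linarith)
  rw [h.normalGap_add_pi] at h3
  linarith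

lemma normalGap_neg (hε : 0 < ε) {τ θ : ℝ} (h1 : τ - π < θ) (h2 : θ < τ) :
    normalGap p (p τ) θ < 0 := by
  have h3 := h.normalGap_pos hε (τ := τ) (θ := θ + π) (by linarith) (by linarith)
  rw [h.normalGap_add_pi] at h3
  linarith

/-- The variation of the support distance of a boundary point to the right of its normal. -/
lemma integral_abs_normalGap_right {τ x y : ℝ} (hx : τ ≤ x) (hxy : x ≤ y) (hy : y ≤ τ + π) :
    ∫ θ in x..y, |normalGap p (p τ) θ| = supportGap p (p τ) y - supportGap p (p τ) x := by
  rw [← h.integral_normalGap, intervalIntegral.integral_of_le hxy,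
    intervalIntegral.integral_of_le hxy, MeasureTheory.integral_Ioc_eq_integral_Ioo,
    MeasureTheory.integral_Ioc_eq_integral_Ioo]
  refine MeasureTheory.setIntegral_congr_fun measurableSet_Ioo fun θ hθ => ?_
  exact abs_of_nonneg (h.normalGap_nonneg (by linarith [hθ.1]) (by linarith [hθ.2]))

lemma integral_abs_normalGap_left {τ x y : ℝ} (hx : τ - π ≤ x) (hxy : x ≤ y) (hy : y ≤ τ) :
    ∫ θ in x..y, |normalGap p (p τ) θ| = supportGap p (p τ) x - supportGap p (p τ) y := by
  rw [← neg_sub, ← h.integral_normalGap, ← intervalIntegral.integral_neg,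
    intervalIntegral.integral_of_le hxy,
    intervalIntegral.integral_of_le hxy, MeasureTheory.integral_Ioc_eq_integral_Ioo,
    MeasureTheory.integral_Ioc_eq_integral_Ioo]
  refine MeasureTheory.setIntegral_congr_fun measurableSet_Ioo fun θ hθ => ?_
  exact abs_of_nonpos (h.normalGap_nonpos (by linarith [hθ.1]) (by linarith [hθ.2]))

lemma intervalIntegrable_abs_normalGap (z : Plane) (x y : ℝ) :
    IntervalIntegrable (fun θ => |normalGap p z θ|) MeasureTheory.volume x y :=
  (h.continuous_normalGap z).abs.intervalIntegrable _ _

lemma integral_abs_normalGap_around {τ x y : ℝ} (hx : τ - π ≤ x) (hxτ : x ≤ τ) (hτy : τ ≤ y)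
    (hy : y ≤ τ + π) :
    ∫ θ in x..y, |normalGap p (p τ) θ| = supportGap p (p τ) x + supportGap p (p τ) y := by
  rw [← intervalIntegral.integral_add_adjacent_intervals
    (h.intervalIntegrable_abs_normalGap _ x τ) (h.intervalIntegrable_abs_normalGap _ τ y),
    h.integral_abs_normalGap_left hx hxτ le_rfl, h.integral_abs_normalGap_right le_rfl hτy hy,
    supportGap_self]
  ring

lemma abs_normalGap_periodic (z : Plane) : Function.Periodic (fun θ => |normalGap p z θ|) π :=
  fun θ => by simp only [h.normalGap_add_pi, abs_neg]

/-- By periodicity the window may start at τ, from where the support distance grows monotonically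
from 0 to w. -/
lemma integral_abs_normalGap_boundary (τ x : ℝ) :
    ∫ θ in x..x + π, |normalGap p (p τ) θ| = w := by
  rw [(h.abs_normalGap_periodic (p τ)).intervalIntegral_add_eq x τ,
    h.integral_abs_normalGap_right le_rfl (by linarith [pi_pos]) le_rfl, h.gap_add_pi, supportGap_self]
  ring

/-- The pseudodistance from a point of a body of constant width to the body is at most the
width. -/
lemma integral_abs_normalGap_le {z : Plane} (hz : z ∈ supportBody p) (x : ℝ) :
    ∫ θ in x..x + π, |normalGap p z θ| ≤ w := by
  -- The gap changes sign over half a turn, so z lies on some normal line, hence on the diameter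
  -- from `p τ` to `p (τ + π)`. Convexity of the absolute value reduces the bound to the two
  -- endpoints.
  obtain ⟨τ, hτ⟩ : ∃ τ, normalGap p z τ = 0 := by
    have h0 := h.normalGap_add_pi z 0
    rw [zero_add] at h0
    rcases le_total 0 (normalGap p z 0) with h1 | h1
    · obtain ⟨τ, -, hτ⟩ := intermediate_value_Icc' pi_pos.le
        (h.continuous_normalGap z).continuousOn (show (0 : ℝ) ∈ _ from ⟨by linarith, h1⟩)
      exact ⟨τ, hτ⟩
    · obtain ⟨τ, -, hτ⟩ := intermediate_value_Icc pi_pos.le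
        (h.continuous_normalGap z).continuousOn (show (0 : ℝ) ∈ _ from ⟨h1, by linarith⟩)
      exact ⟨τ, hτ⟩
  have hzp : z = p τ + supportGap p z τ • unitVec τ := by
    refine eq_of_coord_eq (θ := τ) ?_ ?_
    · rw [ncoord_add, ncoord_smul, ncoord_unitVec]; simp [supportGap]
    · rw [tcoord_add, tcoord_smul, tcoord_unitVec]; simp [normalGap] at hτ ⊢; linarith
  have g0 := supportGap_nonneg hz τ
  have g1 := h.gap_le hz τ
  rcases h.width_nonneg.eq_or_lt with hw | hw
  · have : supportGap p z τ = 0 := by linarith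
    rw [this, zero_smul, add_zero] at hzp
    rw [hzp, h.integral_abs_normalGap_boundary]
  · set t := supportGap p z τ / w with ht
    have ht0 : 0 ≤ t := div_nonneg g0 hw.le
    have ht1 : t ≤ 1 := (div_le_one hw).2 g1
    have hconv : ∀ θ, |normalGap p z θ| ≤
        (1 - t) * |normalGap p (p τ) θ| + t * |normalGap p (p (τ + π)) θ| := by
      intro θ
      have e : normalGap p z θ =
          (1 - t) * normalGap p (p τ) θ + t * normalGap p (p (τ + π)) θ := by
        have e1 : t * w = supportGap p z τ := div_mul_cancel₀ _ hw.ne'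
        simp only [normalGap]
        conv_lhs => rw [hzp]
        rw [h.add_pi, tcoord_add, tcoord_smul, tcoord_add, tcoord_smul, ← e1]
        ring
      rw [e]
      refine (abs_add_le _ _).trans ?_
      rw [abs_mul, abs_mul, abs_of_nonneg ht0, abs_of_nonneg (sub_nonneg.2 ht1)]
    have hi := h.intervalIntegrable_abs_normalGap
    calc ∫ θ in x..x + π, |normalGap p z θ|
        ≤ ∫ θ in x..x + π,
          ((1 - t) * |normalGap p (p τ) θ| + t * |normalGap p (p (τ + π)) θ|) :=
          intervalIntegral.integral_mono_on (by linarith [pi_pos]) (hi _ _ _)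
            (((hi _ _ _).const_mul _).add ((hi _ _ _).const_mul _)) fun θ _ => hconv θ
      _ = w := by
          rw [intervalIntegral.integral_add ((hi _ _ _).const_mul _) ((hi _ _ _).const_mul _),
            intervalIntegral.integral_const_mul, intervalIntegral.integral_const_mul,
            h.integral_abs_normalGap_boundary, h.integral_abs_normalGap_boundary]
          ring

end SupportCurve

/-! ### The median of three numbers -/

/-- The median of three real numbers. -/
noncomputable def median (x y z : ℝ) : ℝ := max (min x y) (min (max x y) z)

lemma median_rotate (x y z : ℝ) : median x y z = median y z x := by
  unfold median; grind

lemma median_swap (x y z : ℝ) : median x y z = median x z y := by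
  unfold median; grind

lemma median_of_le_of_le {x y z : ℝ} (h1 : z ≤ x) (h2 : x ≤ y) : median x y z = x := by
  unfold median; grind

lemma median_of_lt_of_lt {x y z : ℝ} (h1 : x < y) (h2 : x < z) : median x y z = min y z := by
  unfold median; grind

lemma median_neg (x y z : ℝ) : median (-x) (-y) (-z) = -median x y z := by
  unfold median; grind

lemma abs_median_sub_le (x x' y z : ℝ) : |median x y z - median x' y z| ≤ |x - x'| := by
  unfold median; grind

/-- The signed distance from the line in direction `u_θ` through the middle one of three points to
the normal line. -/
noncomputable def medianGap (p : ℝ → Plane) (a b c : Plane) (θ : ℝ) : ℝ :=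
  tcoord θ (p θ) - median (tcoord θ a) (tcoord θ b) (tcoord θ c)

lemma medianGap_rotate (p : ℝ → Plane) (a b c : Plane) (θ : ℝ) :
    medianGap p a b c θ = medianGap p b c a θ := by
  unfold medianGap; rw [median_rotate]

lemma medianGap_swap (p : ℝ → Plane) (a b c : Plane) (θ : ℝ) :
    medianGap p a b c θ = medianGap p a c b θ := by
  unfold medianGap; rw [median_swap]

/-! ### The sign function -/

lemma measurable_sign {f : ℝ → ℝ} (hf : Continuous f) : Measurable fun θ => Real.sign (f θ) := by
  unfold Real.sign
  exact Measurable.ite (measurableSet_lt hf.measurable measurable_const) measurable_const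
    (Measurable.ite (measurableSet_lt measurable_const hf.measurable) measurable_const
      measurable_const)

lemma abs_sign_le_one (x : ℝ) : |Real.sign x| ≤ 1 := by
  rcases Real.sign_apply_eq x with h | h | h <;> simp [h]

lemma sign_mul_self_eq_abs (x : ℝ) : Real.sign x * x = |x| := by
  rcases lt_trichotomy x 0 with h | h | h
  · rw [Real.sign_of_neg h, abs_of_neg h]; ring
  · simp [h]
  · rw [Real.sign_of_pos h, abs_of_pos h]; ring

lemma sign_mul_le_abs (x y : ℝ) : Real.sign x * y ≤ |y| := by
  refine (le_abs_self _).trans ?_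
  rw [abs_mul]
  exact mul_le_of_le_one_left (abs_nonneg y) (abs_sign_le_one x)

lemma intervalIntegrable_sign_mul {f g : ℝ → ℝ} (hf : Continuous f) (hg : Continuous g) (x y : ℝ) :
    IntervalIntegrable (fun θ => Real.sign (f θ) * g θ) MeasureTheory.volume x y := by
  refine (hg.intervalIntegrable x y).mono_fun
    ((measurable_sign hf).mul hg.measurable).aestronglyMeasurable
    (Filter.Eventually.of_forall fun θ => ?_)
  simp only [norm_eq_abs, abs_mul]
  exact mul_le_of_le_one_left (abs_nonneg _) (abs_sign_le_one _)

/-! ### Triangles -/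

/-- The triangle `abc` is positively oriented, its edges `ab`, `ac`, `bc` having the lengths `r₁`,
`r₂`, `r₃` and the directions `θ₁ < θ₂ < θ₃ < θ₁ + π`. -/
structure TriangleFrame (a b c : Plane) (r₁ r₂ r₃ θ₁ θ₂ θ₃ : ℝ) : Prop where
  r₁_pos : 0 < r₁
  r₂_pos : 0 < r₂
  r₃_pos : 0 < r₃
  ab : b - a = r₁ • unitVec θ₁
  ac : c - a = r₂ • unitVec θ₂
  bc : c - b = r₃ • unitVec θ₃
  lt₁₂ : θ₁ < θ₂
  lt₂₃ : θ₂ < θ₃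
  lt₃₁ : θ₃ < θ₁ + π

namespace TriangleFrame

variable {a b c : Plane} {r₁ r₂ r₃ θ₁ θ₂ θ₃ : ℝ} (F : TriangleFrame a b c r₁ r₂ r₃ θ₁ θ₂ θ₃)
include F

/-- Reversing an edge adds π to its direction; facts about the vertex a thereby transfer to b and c.
-/
lemma rotate : TriangleFrame b c a r₃ r₁ r₂ θ₃ (θ₁ + π) (θ₂ + π) where
  r₁_pos := F.r₃_pos
  r₂_pos := F.r₁_pos
  r₃_pos := F.r₂_pos
  ab := F.bc
  ac := by rw [unitVec_add_pi, smul_neg, ← F.ab, neg_sub]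
  bc := by rw [unitVec_add_pi, smul_neg, ← F.ac, neg_sub]
  lt₁₂ := F.lt₃₁
  lt₂₃ := by linarith [F.lt₁₂]
  lt₃₁ := by linarith [F.lt₂₃]

lemma tcoord_ab (θ : ℝ) : tcoord θ b - tcoord θ a = r₁ * sin (θ - θ₁) := by
  rw [← tcoord_sub, F.ab, tcoord_smul, tcoord_unitVec]

lemma tcoord_ac (θ : ℝ) : tcoord θ c - tcoord θ a = r₂ * sin (θ - θ₂) := by
  rw [← tcoord_sub, F.ac, tcoord_smul, tcoord_unitVec]

lemma tcoord_lt_b {θ : ℝ} (h1 : θ₁ < θ) (h2 : θ < θ₁ + π) : tcoord θ a < tcoord θ b := by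
  have := mul_pos F.r₁_pos (sin_pos_of_pos_of_lt_pi (sub_pos.2 h1) (by linarith))
  linarith [F.tcoord_ab θ]

lemma tcoord_lt_c {θ : ℝ} (h1 : θ₂ < θ) (h2 : θ < θ₂ + π) : tcoord θ a < tcoord θ c := by
  have := mul_pos F.r₂_pos (sin_pos_of_pos_of_lt_pi (sub_pos.2 h1) (by linarith))
  linarith [F.tcoord_ac θ]

lemma tcoord_c_lt {θ : ℝ} (h1 : θ₁ < θ) (h2 : θ < θ₂) : tcoord θ c < tcoord θ a := by
  have := mul_neg_of_pos_of_neg F.r₂_pos (sin_neg_of_neg_of_neg_pi_lt (x := θ - θ₂)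
    (by linarith) (by linarith [F.lt₂₃, F.lt₃₁]))
  linarith [F.tcoord_ac θ]

/-- For directions inside the angle at a, the line through a separates b from c. -/
lemma medianGap_eq (p : ℝ → Plane) {θ : ℝ} (h1 : θ₁ < θ) (h2 : θ < θ₂) :
    medianGap p a b c θ = normalGap p a θ := by
  unfold medianGap normalGap
  rw [median_of_le_of_le (F.tcoord_c_lt h1 h2).le
    (F.tcoord_lt_b h1 (by linarith [F.lt₂₃, F.lt₃₁])).le]

end TriangleFrame

/-! ### First variation of the median integral -/

namespace SupportCurve

variable {p : ℝ → Plane} {w ε : ℝ} (h : SupportCurve p w ε)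
include h

lemma continuous_medianGap (a b c : Plane) : Continuous (medianGap p a b c) := by
  have ht : ∀ z, Continuous fun θ => tcoord θ z := fun z =>
    continuous_tcoord_comp continuous_id continuous_const
  unfold medianGap median
  exact (continuous_tcoord_comp continuous_id h.continuous).sub
    (((ht a).min (ht b)).max (((ht a).max (ht b)).min (ht c)))

lemma medianGap_add_pi (a b c : Plane) (θ : ℝ) :
    medianGap p a b c (θ + π) = -medianGap p a b c θ := by
  have := h.normalGap_add_pi 0 θ
  simp only [normalGap, medianGap, tcoord_add_pi, median_neg] at this ⊢
  linarith

lemma abs_medianGap_periodic (a b c : Plane) :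
    Function.Periodic (fun θ => |medianGap p a b c θ|) π :=
  fun θ => by simp only [h.medianGap_add_pi, abs_neg]

/-- The first-order condition for a triangle that maximizes the integral as a function of the
vertex `a`. -/
lemma first_order {a b c : Plane} {r₁ r₂ r₃ θ₁ θ₂ θ₃ : ℝ}
    (F : TriangleFrame a b c r₁ r₂ r₃ θ₁ θ₂ θ₃) (ha : a ∈ supportBody p)
    (hmax : ∀ a' ∈ supportBody p, ∫ θ in (0 : ℝ)..π, |medianGap p a' b c θ| ≤
      ∫ θ in (0 : ℝ)..π, |medianGap p a b c θ|) {z : Plane} (hz : z ∈ supportBody p) :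
    0 ≤ ∫ θ in θ₁..θ₂, Real.sign (normalGap p a θ) * tcoord θ (z - a) := by
  have hshift : ∀ a', ∫ θ in (0 : ℝ)..π, |medianGap p a' b c θ| =
      ∫ θ in θ₁..θ₁ + π, |medianGap p a' b c θ| := fun a' => by
    simpa using (h.abs_medianGap_periodic a' b c).intervalIntegral_add_eq 0 θ₁
  set t : ℕ → ℝ := fun n => 1 / ((n : ℝ) + 1) with ht
  have ht0 : ∀ n, 0 < t n := fun n => Nat.one_div_pos_of_nat
  have ht1 : ∀ n, t n ≤ 1 := fun n => by
    rw [ht]; simp only; rw [div_le_one (by positivity)]; linarith [(Nat.cast_nonneg n : (0:ℝ) ≤ n)]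
  have htlim : Filter.Tendsto t Filter.atTop (nhds 0) := tendsto_one_div_add_atTop_nhds_zero_nat
  set A : ℕ → Plane := fun n => a + t n • (z - a) with hA
  have hAmem : ∀ n, A n ∈ supportBody p := fun n =>
    (convex_supportBody p).add_smul_sub_mem ha hz ⟨(ht0 n).le, ht1 n⟩
  set s : ℝ → ℝ := fun θ => Real.sign (medianGap p a b c θ) with hs
  set D : ℕ → ℝ → ℝ := fun n θ => medianGap p a b c θ - medianGap p (A n) b c θ with hD
  have hDc : ∀ n, Continuous (D n) := fun n =>
    (h.continuous_medianGap a b c).sub (h.continuous_medianGap (A n) b c)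
  -- Maximality at a combined with |x| - |y| ≤ sign(x) (x - y).
  have hpos : ∀ n, 0 ≤ ∫ θ in θ₁..θ₁ + π, s θ * ((t n)⁻¹ * D n θ) := by
    intro n
    have e1 := hmax _ (hAmem n)
    rw [hshift, hshift] at e1
    have i1 := intervalIntegrable_sign_mul (h.continuous_medianGap a b c) (hDc n) θ₁ (θ₁ + π)
    have i2 := (h.continuous_medianGap (A n) b c).abs.intervalIntegrable
      (μ := MeasureTheory.volume) θ₁ (θ₁ + π)
    have e2 : ∫ θ in θ₁..θ₁ + π, |medianGap p a b c θ| ≤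
        ∫ θ in θ₁..θ₁ + π, (s θ * D n θ + |medianGap p (A n) b c θ|) := by
      refine intervalIntegral.integral_mono_on (by linarith [pi_pos])
        ((h.continuous_medianGap a b c).abs.intervalIntegrable _ _) (i1.add i2) fun θ _ => ?_
      have := sign_mul_self_eq_abs (medianGap p a b c θ)
      have := sign_mul_le_abs (medianGap p a b c θ) (medianGap p (A n) b c θ)
      simp only [hs, hD, mul_sub]
      linarith
    rw [intervalIntegral.integral_add i1 i2] at e2
    have e3 : ∫ θ in θ₁..θ₁ + π, s θ * ((t n)⁻¹ * D n θ) =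
        (t n)⁻¹ * ∫ θ in θ₁..θ₁ + π, s θ * D n θ := by
      rw [← intervalIntegral.integral_const_mul]
      exact intervalIntegral.integral_congr fun θ _ => by ring
    rw [e3]
    exact mul_nonneg (inv_nonneg.2 (ht0 n).le) (by linarith)
  -- The limit of the difference quotients: before θ₂ the median is a itself, after θ₂ the point a
  -- is strictly lowest and small moves do not affect the median.
  set G : ℝ → ℝ := fun θ => if θ < θ₂ then s θ * tcoord θ (z - a) else 0 with hG
  have hAt : ∀ n θ, tcoord θ (A n) = tcoord θ a + t n * tcoord θ (z - a) := fun n θ => by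
    simp only [hA, tcoord_add, tcoord_smul]
  have hlim : Filter.Tendsto (fun n => ∫ θ in θ₁..θ₁ + π, s θ * ((t n)⁻¹ * D n θ)) Filter.atTop
      (nhds (∫ θ in θ₁..θ₁ + π, G θ)) := by
    refine intervalIntegral.tendsto_integral_filter_of_dominated_convergence
      (fun _ => ‖z - a‖) ?_ ?_ (by simp) ?_
    · exact Filter.Eventually.of_forall fun n =>
        ((measurable_sign (h.continuous_medianGap a b c)).mul
          ((hDc n).measurable.const_mul _)).aestronglyMeasurable
    · refine Filter.Eventually.of_forall fun n => Filter.Eventually.of_forall fun θ _ => ?_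
      have e1 : |D n θ| ≤ t n * ‖z - a‖ := by
        have := abs_median_sub_le (tcoord θ (A n)) (tcoord θ a) (tcoord θ b) (tcoord θ c)
        have e2 : D n θ = median (tcoord θ (A n)) (tcoord θ b) (tcoord θ c) -
          median (tcoord θ a) (tcoord θ b) (tcoord θ c) := by
          simp only [hD, medianGap]; ring
        rw [e2]
        refine this.trans ?_
        rw [hAt, add_sub_cancel_left, abs_mul, abs_of_pos (ht0 n)]
        exact mul_le_mul_of_nonneg_left (abs_tcoord_le _ _) (ht0 n).le
      rw [norm_eq_abs, abs_mul]
      refine (mul_le_of_le_one_left (abs_nonneg _) (abs_sign_le_one _)).trans ?_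
      rw [abs_mul, abs_of_pos (inv_pos.2 (ht0 n)), inv_mul_le_iff₀ (ht0 n)]
      exact e1
    · have hae : ∀ᵐ θ : ℝ, θ ≠ θ₂ ∧ θ ≠ θ₁ + π := by
        have h1 : ∀ x : ℝ, ∀ᵐ θ : ℝ, θ ≠ x := fun x => by
          rw [MeasureTheory.ae_iff]; simp
        exact (h1 _).and (h1 _)
      filter_upwards [hae] with θ hθ hmem
      rw [Set.uIoc_of_le (by linarith [pi_pos])] at hmem
      have hθπ : θ < θ₁ + π := lt_of_le_of_ne hmem.2 hθ.2
      have hAlim : Filter.Tendsto (fun n => tcoord θ (A n)) Filter.atTop (nhds (tcoord θ a)) := by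
        simp only [hAt]
        simpa using (htlim.mul_const (tcoord θ (z - a))).const_add (tcoord θ a)
      have hb := F.tcoord_lt_b hmem.1 hθπ
      refine Filter.Tendsto.congr' ?_ tendsto_const_nhds
      rcases lt_or_gt_of_ne hθ.1 with h2 | h2
      · have hc := F.tcoord_c_lt hmem.1 h2
        filter_upwards [hAlim.eventually_lt_const hb, hAlim.eventually_const_lt hc] with n n1 n2
        simp only [hG, hD, medianGap, if_pos h2]
        rw [median_of_le_of_le n2.le n1.le, median_of_le_of_le hc.le hb.le, hAt]
        congr 1
        rw [show ∀ x y d : ℝ, x - y - (x - (y + d)) = d by intros; ring,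
          inv_mul_cancel_left₀ (ht0 n).ne']
      · have hc := F.tcoord_lt_c h2 (by linarith [F.lt₁₂])
        filter_upwards [hAlim.eventually_lt_const hb, hAlim.eventually_lt_const hc] with n n1 n2
        simp only [hG, hD, medianGap, if_neg h2.not_gt]
        rw [median_of_lt_of_lt n1 n2, median_of_lt_of_lt hb hc]
        ring
  have hGpos : 0 ≤ ∫ θ in θ₁..θ₁ + π, G θ :=
    ge_of_tendsto hlim (Filter.Eventually.of_forall hpos)
  have hle : θ₂ ≤ θ₁ + π := by linarith [F.lt₂₃, F.lt₃₁]
  have c1 : ∀ᵐ θ : ℝ, θ ∈ Set.uIoc θ₁ θ₂ →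
      G θ = Real.sign (normalGap p a θ) * tcoord θ (z - a) := by
    have h1 : ∀ᵐ θ : ℝ, θ ≠ θ₂ := by rw [MeasureTheory.ae_iff]; simp
    filter_upwards [h1] with θ hθ hmem
    rw [Set.uIoc_of_le F.lt₁₂.le] at hmem
    have h2 : θ < θ₂ := lt_of_le_of_ne hmem.2 hθ
    simp only [hG, if_pos h2, hs, F.medianGap_eq p hmem.1 h2]
  have c2 : ∀ᵐ θ : ℝ, θ ∈ Set.uIoc θ₂ (θ₁ + π) → G θ = 0 := by
    refine Filter.Eventually.of_forall fun θ hmem => ?_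
    rw [Set.uIoc_of_le hle] at hmem
    simp only [hG, if_neg hmem.1.not_gt]
  have i1 : IntervalIntegrable G MeasureTheory.volume θ₁ θ₂ :=
    (intervalIntegrable_sign_mul (h.continuous_normalGap a)
      (continuous_tcoord_comp continuous_id continuous_const) _ _).congr_ae
      ((MeasureTheory.ae_restrict_iff' measurableSet_uIoc).2
        (c1.mono fun θ hθ hm => (hθ hm).symm))
  have i2 : IntervalIntegrable G MeasureTheory.volume θ₂ (θ₁ + π) :=
    (intervalIntegrable_const (c := (0 : ℝ))).congr_ae
      ((MeasureTheory.ae_restrict_iff' measurableSet_uIoc).2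
        (c2.mono fun θ hθ hm => (hθ hm).symm))
  rw [← intervalIntegral.integral_add_adjacent_intervals i1 i2,
    intervalIntegral.integral_congr_ae c1, intervalIntegral.integral_congr_ae c2] at hGpos
  simpa using hGpos

end SupportCurve

/-! ### Consequences of stationarity at one vertex -/

lemma abs_lt_of_cos_pos {x : ℝ} (hx : |x| ≤ π + π / 2) (hc : 0 < cos x) : |x| < π / 2 := by
  by_contra! hle
  rw [← cos_abs] at hc
  exact hc.not_ge (cos_nonpos_of_pi_div_two_le_of_le hle hx)

lemma intervalIntegral_congr_Ioo {f g : ℝ → ℝ} {x y : ℝ} (hxy : x ≤ y)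
    (hfg : ∀ θ, x < θ → θ < y → f θ = g θ) : ∫ θ in x..y, f θ = ∫ θ in x..y, g θ := by
  rw [intervalIntegral.integral_of_le hxy, intervalIntegral.integral_of_le hxy,
    MeasureTheory.integral_Ioc_eq_integral_Ioo, MeasureTheory.integral_Ioc_eq_integral_Ioo]
  exact MeasureTheory.setIntegral_congr_fun measurableSet_Ioo fun θ hθ => hfg θ hθ.1 hθ.2

namespace SupportCurve

variable {p : ℝ → Plane} {w ε : ℝ} (h : SupportCurve p w ε)
include h

/-- The functional `z ↦ ∫ sign(y_a) ⟨v_θ, z⟩` is the inner product with a vector. -/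
lemma exists_sign_vector (a : Plane) (x y : ℝ) : ∃ σ : Plane, ∀ z,
    ∫ θ in x..y, Real.sign (normalGap p a θ) * tcoord θ z = σ 0 * z 0 + σ 1 * z 1 := by
  refine ⟨!₂[∫ θ in x..y, Real.sign (normalGap p a θ) * sin θ,
    ∫ θ in x..y, Real.sign (normalGap p a θ) * -cos θ], fun z => ?_⟩
  have i1 := intervalIntegrable_sign_mul (h.continuous_normalGap a) continuous_sin x y
  have i2 := intervalIntegrable_sign_mul (g := fun θ => -cos θ) (h.continuous_normalGap a)
    continuous_cos.neg x y
  simp only [Matrix.cons_val_zero, Matrix.cons_val_one, Matrix.cons_val_fin_one]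
  rw [← intervalIntegral.integral_mul_const, ← intervalIntegral.integral_mul_const,
    ← intervalIntegral.integral_add (i1.mul_const _) (i2.mul_const _)]
  exact intervalIntegral.integral_congr fun θ _ => by simp only [tcoord]; ring

lemma integral_sign_right {τ x y : ℝ} (hε : 0 < ε) (hx : τ ≤ x) (hxy : x ≤ y) (hy : y ≤ τ + π)
    (z : Plane) : ∫ θ in x..y, Real.sign (normalGap p (p τ) θ) * tcoord θ z =
      ncoord x z - ncoord y z := by
  rw [← integral_tcoord]
  refine intervalIntegral_congr_Ioo hxy fun θ h1 h2 => ?_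
  rw [Real.sign_of_pos (h.normalGap_pos hε (by linarith) (by linarith)), one_mul]

lemma integral_sign_left {τ x y : ℝ} (hε : 0 < ε) (hx : τ - π ≤ x) (hxy : x ≤ y) (hy : y ≤ τ)
    (z : Plane) : ∫ θ in x..y, Real.sign (normalGap p (p τ) θ) * tcoord θ z =
      ncoord y z - ncoord x z := by
  rw [← neg_sub, ← integral_tcoord, ← intervalIntegral.integral_neg]
  refine intervalIntegral_congr_Ioo hxy fun θ h1 h2 => ?_
  rw [Real.sign_of_neg (h.normalGap_neg hε (by linarith) (by linarith))]
  ring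

/-- At a vertex satisfying the first-order condition, either the sign functional vanishes, or the
vertex is the support point in the direction of the bisector. -/
lemma sign_functional_eq_zero_or_bisector {a b c : Plane} {r₁ r₂ r₃ θ₁ θ₂ θ₃ : ℝ} (hε : 0 < ε)
    (F : TriangleFrame a b c r₁ r₂ r₃ θ₁ θ₂ θ₃) (ha : a ∈ supportBody p) (hb : b ∈ supportBody p)
    (hc : c ∈ supportBody p)
    (hfo : ∀ z ∈ supportBody p,
      0 ≤ ∫ θ in θ₁..θ₂, Real.sign (normalGap p a θ) * tcoord θ (z - a)) :
    (∀ z, ∫ θ in θ₁..θ₂, Real.sign (normalGap p a θ) * tcoord θ z = 0) ∨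
      a = p ((θ₁ + θ₂) / 2) := by
  have f1 := F.lt₁₂
  have f2 := F.lt₂₃
  have f3 := F.lt₃₁
  obtain ⟨σ, hσ⟩ := h.exists_sign_vector a θ₁ θ₂
  rcases eq_or_ne σ 0 with h0 | h0
  · left; intro z; rw [hσ, h0]; simp
  right
  -- The period is centered at the bisector, so τ is within π of it.
  obtain ⟨l, τ, hl, hτ1, hτ2, hστ⟩ := exists_polar σ h0 ((θ₁ + θ₂) / 2 - π)
  have hI : ∀ z, ∫ θ in θ₁..θ₂, Real.sign (normalGap p a θ) * tcoord θ z = l * ncoord τ z := by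
    intro z
    rw [hσ, hστ]
    simp [unitVec, ncoord]; ring
  have haτ : a = p τ := by
    refine h.eq_of_gap_eq_zero ha (le_antisymm ?_ (ha τ))
    have := hfo _ (h.mem τ)
    rw [hI, ncoord_sub] at this
    linarith [nonneg_of_mul_nonneg_right this hl]
  -- The support point at τ is unique, so the other vertices lie strictly beyond the supporting line
  -- at a and both edges make acute angles with u_τ.
  have hcos : ∀ {q : Plane} {r α : ℝ}, q ∈ supportBody p → q - a = r • unitVec α → 0 < r →
      0 < cos (τ - α) := by
    intro q r α hq hqr hr
    have e1 : ncoord τ q - ncoord τ a = r * cos (τ - α) := by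
      rw [← ncoord_sub, hqr, ncoord_smul, ncoord_unitVec]
    have e2 : ncoord τ a ≤ ncoord τ q := by rw [haτ]; exact hq τ
    refine lt_of_le_of_ne ?_ fun e3 => ?_
    · exact nonneg_of_mul_nonneg_right (e1 ▸ sub_nonneg.2 e2) hr
    · rw [← e3] at e1
      have : q = p τ := h.eq_of_gap_eq_zero hq (by rw [← haτ]; linarith)
      rw [this, haτ, sub_self] at hqr
      have h5 := congrArg norm hqr
      rw [norm_smul, norm_unitVec, norm_zero, mul_one, norm_eq_abs, abs_of_pos hr] at h5
      exact hr.ne h5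
  have c1 := hcos hb F.ab F.r₁_pos
  have c2 := hcos hc F.ac F.r₂_pos
  have b1 := abs_lt.1 (abs_lt_of_cos_pos (abs_le.2 ⟨by linarith, by linarith⟩) c1)
  have b2 := abs_lt.1 (abs_lt_of_cos_pos (abs_le.2 ⟨by linarith, by linarith⟩) c2)
  -- If τ is outside the open sector, the sign is constant there. Testing with the direction of the
  -- far edge then equates 1 - cos, up to sign, with a quantity of the excluded sign.
  rcases le_total τ θ₁ with h1 | h1
  · have e1 := hI (unitVec θ₂)
    rw [haτ, h.integral_sign_right hε h1 f1.le (by linarith), ncoord_unitVec, ncoord_unitVec,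
      ncoord_unitVec, sub_self, cos_zero] at e1
    linarith [mul_pos hl c2, cos_le_one (θ₁ - θ₂)]
  rcases le_total θ₂ τ with h2 | h2
  · have e1 := hI (unitVec θ₁)
    rw [haτ, h.integral_sign_left hε (by linarith) f1.le h2, ncoord_unitVec, ncoord_unitVec,
      ncoord_unitVec, sub_self, cos_zero] at e1
    linarith [mul_pos hl c1, cos_le_one (θ₂ - θ₁)]
  have hs : ∀ x y, IntervalIntegrable
      (fun θ => Real.sign (normalGap p (p τ) θ) * tcoord θ (tangentVec τ))
      MeasureTheory.volume x y :=
    intervalIntegrable_sign_mul (h.continuous_normalGap _)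
      (continuous_tcoord_comp continuous_id continuous_const)
  -- The functional kills v_τ, so the contributions from the two sides of τ balance; this forces
  -- equal angles to both edges.
  have e1 := hI (tangentVec τ)
  rw [haτ, ← intervalIntegral.integral_add_adjacent_intervals (hs θ₁ τ) (hs τ θ₂),
    h.integral_sign_left hε (by linarith) h1 le_rfl,
    h.integral_sign_right hε le_rfl h2 (by linarith)] at e1
  simp only [ncoord_tangentVec, sub_self, sin_zero, mul_zero] at e1
  have e2 : sin (τ - θ₁) = sin (θ₂ - τ) := by rw [← neg_sub τ θ₂, sin_neg]; linarith
  have e3 := injOn_sin ⟨b1.1.le, b1.2.le⟩ ⟨by linarith, by linarith⟩ e2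
  rw [haτ]; congr 1; linarith

/-- If the sign functional of `a` vanishes, then `a` minimizes the integral over the sector. -/
lemma integral_abs_normalGap_le_of_sign_functional {a : Plane} {x y : ℝ} (hxy : x ≤ y)
    (ha : ∀ z, ∫ θ in x..y, Real.sign (normalGap p a θ) * tcoord θ z = 0) (z : Plane) :
    ∫ θ in x..y, |normalGap p a θ| ≤ ∫ θ in x..y, |normalGap p z θ| := by
  have i1 : ∀ z, IntervalIntegrable (fun θ => Real.sign (normalGap p a θ) * tcoord θ z)
      MeasureTheory.volume x y := fun z => intervalIntegrable_sign_mul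
    (h.continuous_normalGap a) (continuous_tcoord_comp continuous_id continuous_const) _ _
  have i2 := intervalIntegrable_sign_mul (h.continuous_normalGap a)
    (continuous_tcoord_comp continuous_id h.continuous) x y
  -- The sign-weighted gap integral does not depend on z. It equals the absolute integral at a and
  -- bounds the one at z from below.
  have e1 : ∀ z, ∫ θ in x..y, Real.sign (normalGap p a θ) * normalGap p z θ =
      ∫ θ in x..y, Real.sign (normalGap p a θ) * tcoord θ (p θ) := by
    intro z
    simp only [normalGap, mul_sub]
    have := intervalIntegral.integral_sub i2 (i1 z)
    simp only [normalGap] at this ha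
    rw [ha z, sub_zero] at this
    exact this
  simp only [← sign_mul_self_eq_abs (normalGap p a _)]
  rw [e1 a, ← e1 z]
  exact intervalIntegral.integral_mono_on hxy
    (intervalIntegrable_sign_mul (h.continuous_normalGap a) (h.continuous_normalGap _) _ _)
    (h.intervalIntegrable_abs_normalGap _ _ _) fun θ _ => sign_mul_le_abs _ _

/-- The bound for the part of the integral that belongs to one vertex. -/
lemma sector_bound {a : Plane} {θ₁ θ₂ : ℝ} (hlt : θ₁ ≤ θ₂) (hlt' : θ₂ ≤ θ₁ + π)
    (hmem : a ∈ supportBody p)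
    (ha : (∀ z, ∫ θ in θ₁..θ₂, Real.sign (normalGap p a θ) * tcoord θ z = 0) ∨
      a = p ((θ₁ + θ₂) / 2)) :
    ∫ θ in θ₁..θ₂, |normalGap p a θ| ≤ supportGap p a θ₁ + supportGap p a θ₂ := by
  set m := (θ₁ + θ₂) / 2 with hm
  have key := h.integral_abs_normalGap_around (τ := m) (x := θ₁) (y := θ₂) (by linarith)
    (by linarith) (by linarith) (by linarith)
  rcases ha with ha | ha
  -- Comparison with the support point at the bisector m: up to the support function, the sum of the
  -- two end gaps is a nonnegative multiple of the coordinate along u_m, which is least at `p m`.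
  · refine (h.integral_abs_normalGap_le_of_sign_functional hlt ha (p m)).trans (key.le.trans ?_)
    have e3 := ncoord_sum_angles θ₁ θ₂ a
    have e4 := ncoord_sum_angles θ₁ θ₂ (p m)
    have e5 : 0 ≤ cos ((θ₂ - θ₁) / 2) :=
      cos_nonneg_of_neg_pi_div_two_le_of_le (by linarith) (by linarith)
    have e6 := mul_nonneg e5 (sub_nonneg.2 (hmem m))
    simp only [supportGap]
    rw [← hm] at e3 e4
    nlinarith
  · rw [ha]; exact key.le

end SupportCurve

/-! ### Triangles with two bisectors normal to the body -/

/-- The inequality between the width and a side of a triangle two of whose bisectors are diameters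
of the body; `X, Y` and `S, T` are the cosines and sines of the half angles. -/
lemma width_mul_le_of_bisectors {X Y S T w C : ℝ} (hX : 0 ≤ X) (hY : 0 ≤ Y) (hS : 0 ≤ S)
    (hT : 0 ≤ T) (hXS : S ^ 2 + X ^ 2 = 1) (hYT : T ^ 2 + Y ^ 2 = 1) (hZ : 0 ≤ X * Y - S * T)
    (hC : 0 ≤ C) (hq : (C - w * (Y + X)) ^ 2 + (w * (S - T)) ^ 2 ≤ w ^ 2) :
    w * (X * Y - S * T) ≤ C * (X * Y) := by
  by_contra! hlt
  set Z := X * Y - S * T with hZdef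
  have hX1 : X ≤ 1 := by nlinarith
  have hY1 : Y ≤ 1 := by nlinarith
  have hQ : C ^ 2 - 2 * C * w * (X + Y) + w ^ 2 * (1 + 2 * Z) ≤ 0 := by
    have : (C - w * (Y + X)) ^ 2 + (w * (S - T)) ^ 2 - w ^ 2 =
        C ^ 2 - 2 * C * w * (X + Y) + w ^ 2 * (1 + 2 * Z) := by
      rw [hZdef]; linear_combination w ^ 2 * hXS + w ^ 2 * hYT
    linarith
  set u := w * Z - C * (X * Y) with hu
  have hu0 : 0 < u := sub_pos.2 hlt
  have hXY : 0 ≤ X * Y := mul_nonneg hX hY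
  have hZle : Z ≤ X * Y := by rw [hZdef]; linarith [mul_nonneg hS hT]
  have a1 : 0 ≤ (X * Y - Z) ^ 2 + 2 * Z * (X * Y) * ((1 - X) * (1 - Y)) := by
    have := mul_nonneg (sub_nonneg.2 hX1) (sub_nonneg.2 hY1)
    positivity
  have a2 : 0 ≤ X * Y - Z * (X + Y - 2 * (X * Y)) := by
    have b1 : X + Y - 2 * (X * Y) ≤ 1 := by nlinarith
    have b2 : 0 ≤ X + Y - 2 * (X * Y) := by nlinarith
    nlinarith
  -- Substituting w Z = u + C X Y exhibits Z² times the nonpositive quadratic `hQ` as a sum of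
  -- nonnegative terms, the last of them positive.
  have e : Z ^ 2 * (C ^ 2 - 2 * C * w * (X + Y) + w ^ 2 * (1 + 2 * Z)) =
      C ^ 2 * ((X * Y - Z) ^ 2 + 2 * Z * (X * Y) * ((1 - X) * (1 - Y))) +
      2 * C * u * (X * Y - Z * (X + Y - 2 * (X * Y))) + (1 + 2 * Z) * u ^ 2 := by
    rw [hu]; ring
  have f1 : Z ^ 2 * (C ^ 2 - 2 * C * w * (X + Y) + w ^ 2 * (1 + 2 * Z)) ≤ 0 :=
    mul_nonpos_of_nonneg_of_nonpos (sq_nonneg _) hQ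
  have f2 : 0 < (1 + 2 * Z) * u ^ 2 := by positivity
  have f3 := mul_nonneg (sq_nonneg C) a1
  have f4 := mul_nonneg (mul_nonneg (mul_nonneg two_pos.le hC) hu0.le) a2
  linarith

namespace SupportCurve

variable {p : ℝ → Plane} {w ε : ℝ} (h : SupportCurve p w ε)
include h

lemma add_two_pi (θ : ℝ) : p (θ + π + π) = p θ := by
  rw [h.add_pi, h.add_pi, unitVec_add_pi]; simp

variable {a b c : Plane} {r₁ r₂ r₃ θ₁ θ₂ θ₃ : ℝ} (F : TriangleFrame a b c r₁ r₂ r₃ θ₁ θ₂ θ₃)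
include F

/-- If the bisectors of a triangle at two vertices are normals of the body, then the perimeter is
at least twice the width. -/
lemma two_mul_width_le (ha : a = p ((θ₁ + θ₂) / 2)) (hb : b = p ((θ₃ + (θ₁ + π)) / 2)) :
    2 * w ≤ r₁ + r₂ + r₃ := by
  have f1 := F.lt₁₂
  have f2 := F.lt₂₃
  have f3 := F.lt₃₁
  -- x and y are the half angles at a and b.
  set x := (θ₂ - θ₁) / 2 with hx
  set y := (θ₁ + π - θ₃) / 2 with hy
  have hθ₂ : θ₂ = θ₁ + 2 * x := by rw [hx]; ring
  have hθ₃ : θ₃ = θ₁ + π - 2 * y := by rw [hy]; ring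
  have hx0 : 0 < x := by linarith
  have hy0 : 0 < y := by linarith
  have hxy : x + y < π / 2 := by linarith
  have hsum : c - a = (b - a) + (c - b) := by abel
  rw [F.ab, F.ac, F.bc] at hsum
  have n1 := congrArg (ncoord θ₁) hsum
  have t1 := congrArg (tcoord θ₁) hsum
  simp only [ncoord_add, ncoord_smul, ncoord_unitVec, tcoord_add, tcoord_smul,
    tcoord_unitVec, sub_self, cos_zero, sin_zero, mul_zero, zero_add, mul_one] at n1 t1
  rw [show θ₁ - θ₂ = -(2 * x) by linarith, show θ₁ - θ₃ = -(π - 2 * y) by linarith, cos_neg,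
    cos_neg, cos_pi_sub] at n1
  rw [show θ₁ - θ₂ = -(2 * x) by linarith, show θ₁ - θ₃ = -(π - 2 * y) by linarith, sin_neg,
    sin_neg, sin_pi_sub] at t1
  -- The far ends of the diameters issuing from a and b along the bisectors are at distance at most
  -- w.
  have hq : (r₁ - w * (cos y + cos x)) ^ 2 + (w * (sin x - sin y)) ^ 2 ≤ w ^ 2 := by
    have e1 := h.norm_sub_le (h.mem ((θ₃ + (θ₁ + π)) / 2 + π)) (h.mem ((θ₁ + θ₂) / 2 + π))
    have e2 := ncoord_sq_add_tcoord_sq θ₁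
      (p ((θ₃ + (θ₁ + π)) / 2 + π) - p ((θ₁ + θ₂) / 2 + π))
    have e3 : p ((θ₃ + (θ₁ + π)) / 2 + π) - p ((θ₁ + θ₂) / 2 + π) =
        r₁ • unitVec θ₁ + w • unitVec (θ₁ + (π - y)) - w • unitVec (θ₁ + x) := by
      rw [h.add_pi, h.add_pi, ← ha, ← hb, ← F.ab,
        show (θ₃ + (θ₁ + π)) / 2 = θ₁ + (π - y) by linarith,
        show (θ₁ + θ₂) / 2 = θ₁ + x by linarith]
      abel
    have e4 : ‖p ((θ₃ + (θ₁ + π)) / 2 + π) - p ((θ₁ + θ₂) / 2 + π)‖ ^ 2 ≤ w ^ 2 :=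
      pow_le_pow_left₀ (norm_nonneg _) e1 2
    rw [← e2, e3] at e4
    simp only [ncoord_sub, ncoord_add, ncoord_smul, ncoord_unitVec, tcoord_sub, tcoord_add,
      tcoord_smul, tcoord_unitVec, sub_add_cancel_left, cos_neg, sin_neg, cos_pi_sub, sin_pi_sub,
      sub_self, cos_zero, sin_zero] at e4
    refine le_of_eq_of_le ?_ e4
    ring
  have hsz : 0 < sin (x + y) := sin_pos_of_pos_of_lt_pi (by linarith) (by linarith)
  have hcz : 0 < cos (x + y) := cos_pos_of_mem_Ioo ⟨by linarith, hxy⟩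
  have hcx : 0 ≤ cos x := cos_nonneg_of_neg_pi_div_two_le_of_le (by linarith) (by linarith)
  have hcy : 0 ≤ cos y := cos_nonneg_of_neg_pi_div_two_le_of_le (by linarith) (by linarith)
  have hsx : 0 ≤ sin x := sin_nonneg_of_nonneg_of_le_pi hx0.le (by linarith)
  have hsy : 0 ≤ sin y := sin_nonneg_of_nonneg_of_le_pi hy0.le (by linarith)
  have key := width_mul_le_of_bisectors hcx hcy hsx hsy (sin_sq_add_cos_sq x)
    (sin_sq_add_cos_sq y) (by rw [← cos_add]; exact hcz.le) F.r₁_pos.le hq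
  rw [← cos_add] at key
  -- Mollweide's formula, obtained from the law of sines.
  have hr : (r₂ + r₃) * cos (x + y) = r₁ * cos (x - y) := by
    refine mul_left_cancel₀ (mul_pos two_pos hsz).ne' ?_
    have e1 : r₂ * sin (2 * x + 2 * y) = r₁ * sin (2 * y) := by
      rw [sin_add]; linear_combination sin (2 * y) * n1 - cos (2 * y) * t1
    have e2 : r₃ * sin (2 * x + 2 * y) = r₁ * sin (2 * x) := by
      rw [sin_add]; linear_combination sin (2 * x) * n1 + cos (2 * x) * t1
    have e3 : sin (2 * x + 2 * y) = 2 * sin (x + y) * cos (x + y) := by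
      rw [← sin_two_mul, mul_add]
    have e4 : sin (2 * x) + sin (2 * y) = 2 * sin (x + y) * cos (x - y) := by
      rw [sin_add_sin]; congr 3 <;> ring
    linear_combination e1 + e2 + r₁ * e4 - (r₂ + r₃) * e3
  refine le_of_mul_le_mul_right ?_ hcz
  have e5 : cos (x + y) + cos (x - y) = 2 * (cos x * cos y) := by
    rw [cos_add, cos_sub]; ring
  have e6 : r₁ * cos (x + y) + r₁ * cos (x - y) = 2 * (r₁ * (cos x * cos y)) := by
    linear_combination r₁ * e5
  linarith

/-- The three angle sectors tile half a turn, once the sector of c is shifted by the period π. -/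
lemma integral_medianGap_eq : ∫ θ in (0 : ℝ)..π, |medianGap p a b c θ| =
    (∫ θ in θ₁..θ₂, |normalGap p a θ|) + (∫ θ in θ₃..θ₁ + π, |normalGap p b θ|) +
      ∫ θ in θ₂ + π..θ₃ + π, |normalGap p c θ| := by
  have f1 := F.lt₁₂
  have f2 := F.lt₂₃
  have f3 := F.lt₃₁
  have hi : ∀ x y, IntervalIntegrable (fun θ => |medianGap p a b c θ|)
    MeasureTheory.volume x y := (h.continuous_medianGap a b c).abs.intervalIntegrable
  have e0 : ∫ θ in (0 : ℝ)..π, |medianGap p a b c θ| =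
      ∫ θ in θ₁..θ₁ + π, |medianGap p a b c θ| := by
    simpa using (h.abs_medianGap_periodic a b c).intervalIntegral_add_eq 0 θ₁
  have e1 : ∫ θ in θ₂..θ₃, |medianGap p a b c θ| =
      ∫ θ in θ₂ + π..θ₃ + π, |medianGap p a b c θ| := by
    rw [← intervalIntegral.integral_comp_add_right]
    exact intervalIntegral.integral_congr fun θ _ => (h.abs_medianGap_periodic a b c θ).symm
  have s1 := intervalIntegral_congr_Ioo f1.le (f := fun θ => |medianGap p a b c θ|)
    (g := fun θ => |normalGap p a θ|) fun θ h1 h2 => by rw [F.medianGap_eq p h1 h2]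
  have s2 := intervalIntegral_congr_Ioo f3.le (f := fun θ => |medianGap p a b c θ|)
    (g := fun θ => |normalGap p b θ|) fun θ h1 h2 => by
      rw [medianGap_rotate, F.rotate.medianGap_eq p h1 h2]
  have s3 := intervalIntegral_congr_Ioo (show θ₂ + π ≤ θ₃ + π by linarith)
    (f := fun θ => |medianGap p a b c θ|) (g := fun θ => |normalGap p c θ|) fun θ h1 h2 => by
      rw [medianGap_rotate, medianGap_rotate, F.rotate.rotate.medianGap_eq p h1 h2]
  rw [e0, ← intervalIntegral.integral_add_adjacent_intervals (hi θ₁ θ₃) (hi _ _),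
    ← intervalIntegral.integral_add_adjacent_intervals (hi θ₁ θ₂) (hi _ _), e1, s1, s2, s3]
  ring

/-- The triangle inequality for a triangle at which the integral is stationary. -/
lemma integral_medianGap_le_of_stationary (hma : a ∈ supportBody p) (hmb : b ∈ supportBody p)
    (hmc : c ∈ supportBody p)
    (ha : (∀ z, ∫ θ in θ₁..θ₂, Real.sign (normalGap p a θ) * tcoord θ z = 0) ∨
      a = p ((θ₁ + θ₂) / 2))
    (hb : (∀ z, ∫ θ in θ₃..θ₁ + π, Real.sign (normalGap p b θ) * tcoord θ z = 0) ∨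
      b = p ((θ₃ + (θ₁ + π)) / 2))
    (hc : (∀ z, ∫ θ in θ₂ + π..θ₃ + π, Real.sign (normalGap p c θ) * tcoord θ z = 0) ∨
      c = p ((θ₂ + π + (θ₃ + π)) / 2)) :
    ∫ θ in (0 : ℝ)..π, |medianGap p a b c θ| ≤ w := by
  have f1 := F.lt₁₂
  have f2 := F.lt₂₃
  have f3 := F.lt₃₁
  -- By `gap_add_pi`, the three sector bounds add up to 3w minus the perimeter.
  have two_bisectors : 2 * w ≤ r₁ + r₂ + r₃ → ∫ θ in (0 : ℝ)..π, |medianGap p a b c θ| ≤ w := by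
    intro hw
    rw [h.integral_medianGap_eq F]
    have s1 := h.sector_bound f1.le (by linarith) hma ha
    have s2 := h.sector_bound f3.le (by linarith) hmb hb
    have s3 := h.sector_bound (by linarith) (by linarith) hmc hc
    simp only [h.gap_add_pi] at s1 s2 s3
    have g1 : supportGap p b θ₁ - supportGap p a θ₁ = r₁ := by
      have : ncoord θ₁ (b - a) = r₁ := by simp [F.ab, ncoord_smul, ncoord_unitVec]
      rw [← this, ncoord_sub]; simp [supportGap]
    have g2 : supportGap p c θ₂ - supportGap p a θ₂ = r₂ := by
      have : ncoord θ₂ (c - a) = r₂ := by simp [F.ac, ncoord_smul, ncoord_unitVec]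
      rw [← this, ncoord_sub]; simp [supportGap]
    have g3 : supportGap p c θ₃ - supportGap p b θ₃ = r₃ := by
      have : ncoord θ₃ (c - b) = r₃ := by simp [F.bc, ncoord_smul, ncoord_unitVec]
      rw [← this, ncoord_sub]; simp [supportGap]
    linarith
  -- If z does at least as badly as each vertex in its own sector, the total is at most the
  -- pseudodistance of z. Below, z is a vertex whose functional need not vanish.
  have two_zeros : ∀ z ∈ supportBody p,
      ((∫ θ in θ₁..θ₂, |normalGap p a θ|) ≤ ∫ θ in θ₁..θ₂, |normalGap p z θ|) →
      ((∫ θ in θ₃..θ₁ + π, |normalGap p b θ|) ≤ ∫ θ in θ₃..θ₁ + π, |normalGap p z θ|) →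
      ((∫ θ in θ₂ + π..θ₃ + π, |normalGap p c θ|) ≤ ∫ θ in θ₂ + π..θ₃ + π, |normalGap p z θ|) →
      ∫ θ in (0 : ℝ)..π, |medianGap p a b c θ| ≤ w := by
    intro z hz z1 z2 z3
    rw [h.integral_medianGap_eq F]
    have hi := h.intervalIntegrable_abs_normalGap z
    have e1 : ∫ θ in θ₂..θ₃, |normalGap p z θ| = ∫ θ in θ₂ + π..θ₃ + π, |normalGap p z θ| := by
      rw [← intervalIntegral.integral_comp_add_right]
      exact intervalIntegral.integral_congr fun θ _ => (h.abs_normalGap_periodic z θ).symm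
    have e2 := h.integral_abs_normalGap_le hz θ₁
    rw [← intervalIntegral.integral_add_adjacent_intervals (hi θ₁ θ₃) (hi _ _),
      ← intervalIntegral.integral_add_adjacent_intervals (hi θ₁ θ₂) (hi _ _), e1] at e2
    linarith
  have za := fun H => h.integral_abs_normalGap_le_of_sign_functional (a := a) f1.le H
  have zb := fun H => h.integral_abs_normalGap_le_of_sign_functional (a := b) f3.le H
  have zc := fun H => h.integral_abs_normalGap_le_of_sign_functional (a := c)
    (show θ₂ + π ≤ θ₃ + π by linarith) H
  rcases ha with ha | ha <;> rcases hb with hb | hb <;> rcases hc with hc | hc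
  · exact two_zeros a hma le_rfl (zb hb a) (zc hc a)
  · exact two_zeros c hmc (za ha c) (zb hb c) le_rfl
  · exact two_zeros b hmb (za ha b) le_rfl (zc hc b)
  · have := h.two_mul_width_le F.rotate hb (hc.trans (by ring_nf))
    exact two_bisectors (by linarith)
  · exact two_zeros a hma le_rfl (zb hb a) (zc hc a)
  · have := h.two_mul_width_le F.rotate.rotate hc (ha.trans (by
      rw [← h.add_two_pi]; congr 1; ring))
    exact two_bisectors (by linarith)
  · exact two_bisectors (h.two_mul_width_le F ha hb)
  · exact two_bisectors (h.two_mul_width_le F ha hb)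

end SupportCurve

/-! ### Degenerate triples and existence of a maximizer -/

lemma exists_triangleFrame_of_polar {a b c : Plane} {r₁ r₂ θ₁ θ₂ : ℝ} (hr₁ : 0 < r₁)
    (hr₂ : 0 < r₂) (hab : b - a = r₁ • unitVec θ₁) (hac : c - a = r₂ • unitVec θ₂)
    (h1 : θ₁ < θ₂) (h2 : θ₂ < θ₁ + π) :
    ∃ r₃ θ₃, TriangleFrame a b c r₁ r₂ r₃ θ₁ θ₂ θ₃ := by
  have hs : 0 < sin (θ₂ - θ₁) := sin_pos_of_pos_of_lt_pi (by linarith) (by linarith)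
  have hbc : c - b = r₂ • unitVec θ₂ - r₁ • unitVec θ₁ := by rw [← hab, ← hac]; abel
  have t1 : tcoord θ₁ (c - b) = -(r₂ * sin (θ₂ - θ₁)) := by
    rw [hbc, tcoord_sub, tcoord_smul, tcoord_smul, tcoord_unitVec, tcoord_unitVec,
      ← neg_sub θ₂ θ₁, sin_neg]; simp
  have t2 : tcoord θ₂ (c - b) = -(r₁ * sin (θ₂ - θ₁)) := by
    rw [hbc, tcoord_sub, tcoord_smul, tcoord_smul, tcoord_unitVec, tcoord_unitVec]; simp
  have hne : c - b ≠ 0 := by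
    intro h0
    rw [h0] at t1
    simp only [tcoord, PiLp.zero_apply, mul_zero, sub_zero] at t1
    linarith [mul_pos hr₂ hs]
  obtain ⟨r₃, θ₃, hr₃, b1, b2, e⟩ := exists_polar _ hne θ₁
  have s1 : 0 < sin (θ₃ - θ₁) := by
    rw [e, tcoord_smul, tcoord_unitVec, ← neg_sub θ₃ θ₁, sin_neg] at t1
    refine pos_of_mul_pos_right (a := r₃) ?_ hr₃.le
    linarith [mul_pos hr₂ hs]
  have s2 : 0 < sin (θ₃ - θ₂) := by
    rw [e, tcoord_smul, tcoord_unitVec, ← neg_sub θ₃ θ₂, sin_neg] at t2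
    refine pos_of_mul_pos_right (a := r₃) ?_ hr₃.le
    linarith [mul_pos hr₁ hs]
  have b3 : θ₃ < θ₁ + π := by
    by_contra! hle
    have := sin_nonneg_of_nonneg_of_le_pi (x := θ₃ - θ₁ - π) (by linarith) (by linarith)
    rw [sin_sub_pi] at this
    linarith
  have b4 : θ₂ < θ₃ := by
    by_contra! hle
    have := sin_nonpos_of_nonpos_of_neg_pi_le (x := θ₃ - θ₂) (by linarith) (by linarith)
    linarith
  exact ⟨r₃, θ₃, hr₁, hr₂, hr₃, hab, hac, e, h1, b4, b3⟩

/-- Three points are the vertices of a proper triangle, or one of them lies between the others. -/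
lemma exists_triangleFrame_or_mem_segment (a b c : Plane) :
    (∃ r₁ r₂ r₃ θ₁ θ₂ θ₃, TriangleFrame a b c r₁ r₂ r₃ θ₁ θ₂ θ₃) ∨
    (∃ r₁ r₂ r₃ θ₁ θ₂ θ₃, TriangleFrame a c b r₁ r₂ r₃ θ₁ θ₂ θ₃) ∨
    a ∈ segment ℝ b c ∨ b ∈ segment ℝ a c ∨ c ∈ segment ℝ a b := by
  rcases eq_or_ne (b - a) 0 with hba | hba
  · right; right; right; left
    rw [sub_eq_zero.1 hba]; exact left_mem_segment ℝ a c
  rcases eq_or_ne (c - a) 0 with hca | hca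
  · right; right; right; right
    rw [sub_eq_zero.1 hca]; exact left_mem_segment ℝ a b
  obtain ⟨r₁, θ₁, hr₁, -, -, e₁⟩ := exists_polar _ hba 0
  obtain ⟨r₂, θ₂, hr₂, l1, l2, e₂⟩ := exists_polar _ hca θ₁
  have hb : b = a + r₁ • unitVec θ₁ := by rw [← e₁]; abel
  have hc : c = a + r₂ • unitVec θ₂ := by rw [← e₂]; abel
  have hper : unitVec (θ₁ + 2 * π) = unitVec θ₁ := by
    have := unitVec_add_int_mul θ₁ 1
    rwa [Int.cast_one, one_mul] at this
  rcases lt_trichotomy θ₂ (θ₁ + π) with l3 | l3 | l3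
  · left
    obtain ⟨r₃, θ₃, F⟩ := exists_triangleFrame_of_polar hr₁ hr₂ e₁ e₂ l1 l3
    exact ⟨_, _, _, _, _, _, F⟩
  · right; right; left
    rw [l3, unitVec_add_pi] at hc
    refine ⟨r₂ / (r₁ + r₂), r₁ / (r₁ + r₂), by positivity, by positivity, by field_simp; ring, ?_⟩
    rw [hb, hc]
    have : r₂ / (r₁ + r₂) + r₁ / (r₁ + r₂) = 1 := by field_simp; ring
    calc _ = (r₂ / (r₁ + r₂) + r₁ / (r₁ + r₂)) • a +
          (r₂ / (r₁ + r₂) * r₁ - r₁ / (r₁ + r₂) * r₂) • unitVec θ₁ := by module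
      _ = a := by
        rw [this, show r₂ / (r₁ + r₂) * r₁ - r₁ / (r₁ + r₂) * r₂ = 0 by ring]; simp
  · rcases l2.lt_or_eq with l4 | l4
    · right; left
      obtain ⟨r₃, θ₃, F⟩ := exists_triangleFrame_of_polar (θ₂ := θ₁ + 2 * π) hr₂ hr₁ e₂
        (by rw [hper, e₁]) l4 (by linarith)
      exact ⟨_, _, _, _, _, _, F⟩
    · right; right; right
      rw [l4, hper] at hc
      have key : ∀ r r' : ℝ, 0 < r → r ≤ r' →
          a + r • unitVec θ₁ ∈ segment ℝ a (a + r' • unitVec θ₁) := by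
        intro r r' hr hrr
        rw [segment_eq_image']
        have hr' : 0 < r' := hr.trans_le hrr
        refine ⟨r / r', ⟨by positivity, (div_le_one hr').2 hrr⟩, ?_⟩
        simp only [add_sub_cancel_left, smul_smul, div_mul_cancel₀ _ hr'.ne']
      rcases le_total r₁ r₂ with hle | hle
      · left; rw [hb, hc]; exact key _ _ hr₁ hle
      · right; rw [hb, hc]; exact key _ _ hr₂ hle

/-- A linear coordinate preserves betweenness, so a degenerate triple reduces to its middle point.
-/
lemma medianGap_of_mem_segment (p : ℝ → Plane) {a b c : Plane} (ha : a ∈ segment ℝ b c) (θ : ℝ) :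
    medianGap p a b c θ = normalGap p a θ := by
  obtain ⟨s, t, hs, ht, hst, rfl⟩ := ha
  unfold medianGap normalGap
  congr 1
  rw [tcoord_add, tcoord_smul, tcoord_smul]
  obtain rfl : s = 1 - t := by linarith
  unfold median
  rcases le_total (tcoord θ b) (tcoord θ c) with h1 | h1
  · have e1 : tcoord θ b ≤ (1 - t) * tcoord θ b + t * tcoord θ c := by nlinarith
    have e2 : (1 - t) * tcoord θ b + t * tcoord θ c ≤ tcoord θ c := by nlinarith
    rw [min_eq_right e1, max_eq_left e1, min_eq_left e2, max_eq_right e1]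
  · have e1 : (1 - t) * tcoord θ b + t * tcoord θ c ≤ tcoord θ b := by nlinarith
    have e2 : tcoord θ c ≤ (1 - t) * tcoord θ b + t * tcoord θ c := by nlinarith
    rw [min_eq_left e1, max_eq_right e1, min_eq_right (e2.trans e1), max_eq_left e2]

lemma isClosed_supportBody (p : ℝ → Plane) : IsClosed (supportBody p) := by
  have : supportBody p = ⋂ θ, {z | ncoord θ (p θ) ≤ ncoord θ z} := by
    ext z; simp [supportBody]
  rw [this]
  exact isClosed_iInter fun θ => isClosed_le continuous_const
    (continuous_ncoord_comp continuous_const continuous_id)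

namespace SupportCurve

variable {p : ℝ → Plane} {w ε : ℝ}

lemma isCompact_supportBody (h : SupportCurve p w ε) : IsCompact (supportBody p) :=
  Metric.isCompact_of_isClosed_isBounded (isClosed_supportBody p)
    (Metric.isBounded_iff.2 ⟨w, fun _ hx _ hy => by
      rw [dist_eq_norm]; exact h.norm_sub_le hx hy⟩)

lemma integral_medianGap_le_of_isMax (h : SupportCurve p w ε) (hε : 0 < ε) {a b c : Plane}
    {r₁ r₂ r₃ θ₁ θ₂ θ₃ : ℝ} (F : TriangleFrame a b c r₁ r₂ r₃ θ₁ θ₂ θ₃)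
    (ha : a ∈ supportBody p) (hb : b ∈ supportBody p) (hc : c ∈ supportBody p)
    (hmax : ∀ a' ∈ supportBody p, ∀ b' ∈ supportBody p, ∀ c' ∈ supportBody p,
      ∫ θ in (0 : ℝ)..π, |medianGap p a' b' c' θ| ≤ ∫ θ in (0 : ℝ)..π, |medianGap p a b c θ|) :
    ∫ θ in (0 : ℝ)..π, |medianGap p a b c θ| ≤ w := by
  refine h.integral_medianGap_le_of_stationary F ha hb hc
    (h.sign_functional_eq_zero_or_bisector hε F ha hb hc fun z hz =>
      h.first_order F ha (fun a' ha' => hmax a' ha' b hb c hc) hz)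
    (h.sign_functional_eq_zero_or_bisector hε F.rotate hb hc ha fun z hz =>
      h.first_order F.rotate hb (fun b' hb' => ?_) hz)
    (h.sign_functional_eq_zero_or_bisector hε F.rotate.rotate hc ha hb fun z hz =>
      h.first_order F.rotate.rotate hc (fun c' hc' => ?_) hz)
  · have := hmax a ha b' hb' c hc
    simpa only [medianGap_rotate p a] using this
  · have := hmax a ha b hb c' hc'
    simpa only [medianGap_rotate p a, medianGap_rotate p b] using this

/-- The integral is continuous on the compact set of triples; a maximizing triple is either
degenerate or, up to orientation, a stationary proper triangle. -/
lemma integral_medianGap_le_of_pos (h : SupportCurve p w ε) (hε : 0 < ε) {a b c : Plane}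
    (ha : a ∈ supportBody p) (hb : b ∈ supportBody p) (hc : c ∈ supportBody p) :
    ∫ θ in (0 : ℝ)..π, |medianGap p a b c θ| ≤ w := by
  have hK := h.isCompact_supportBody
  have hcont : Continuous fun x : Plane × Plane × Plane =>
      ∫ θ in (0 : ℝ)..π, |medianGap p x.1 x.2.1 x.2.2 θ| := by
    refine intervalIntegral.continuous_parametric_intervalIntegral_of_continuous' ?_ _ _
    have ht : ∀ g : Plane × Plane × Plane → Plane, Continuous g →
        Continuous fun y : (Plane × Plane × Plane) × ℝ => tcoord y.2 (g y.1) := fun g hg =>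
      continuous_tcoord_comp continuous_snd (hg.comp continuous_fst)
    have h1 := ht _ continuous_fst
    have h2 := ht _ (continuous_fst.comp continuous_snd)
    have h3 := ht _ (continuous_snd.comp continuous_snd)
    simp only [Function.uncurry_def, medianGap, median]
    exact ((continuous_tcoord_comp continuous_snd (h.continuous.comp continuous_snd)).sub
      ((h1.min h2).max ((h1.max h2).min h3))).abs
  obtain ⟨⟨a', b', c'⟩, ⟨ha', hb', hc'⟩, hmax⟩ :=
    (hK.prod (hK.prod hK)).exists_isMaxOn ⟨(a, b, c), ha, hb, hc⟩ hcont.continuousOn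
  have hmax' : ∀ x ∈ supportBody p, ∀ y ∈ supportBody p, ∀ z ∈ supportBody p,
      ∫ θ in (0 : ℝ)..π, |medianGap p x y z θ| ≤ ∫ θ in (0 : ℝ)..π, |medianGap p a' b' c' θ| :=
    fun x hx y hy z hz => hmax (show (x, y, z) ∈ _ from ⟨hx, hy, hz⟩)
  refine (hmax' a ha b hb c hc).trans ?_
  have seg : ∀ {x y z}, x ∈ supportBody p → x ∈ segment ℝ y z →
      ∫ θ in (0 : ℝ)..π, |medianGap p x y z θ| ≤ w := by
    intro x y z hx hm
    simp only [medianGap_of_mem_segment p hm]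
    have := h.integral_abs_normalGap_le hx 0
    rwa [zero_add] at this
  rcases exists_triangleFrame_or_mem_segment a' b' c' with
    ⟨_, _, _, _, _, _, F⟩ | ⟨_, _, _, _, _, _, F⟩ | hm | hm | hm
  · exact h.integral_medianGap_le_of_isMax hε F ha' hb' hc' hmax'
  · simp only [medianGap_swap p a' b' c'] at hmax' ⊢
    exact h.integral_medianGap_le_of_isMax hε F ha' hc' hb' hmax'
  · exact seg ha' hm
  · have := seg hb' hm
    simpa only [medianGap_swap p b' a' c', medianGap_rotate p b' c' a',
      medianGap_rotate p c' a' b'] using this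
  · have := seg hc' hm
    simpa only [medianGap_rotate p c' a' b'] using this

/-- The outer parallel curve. -/
lemma parallel (h : SupportCurve p w ε) {δ : ℝ} (hδ : 0 ≤ δ) :
    SupportCurve (fun θ => p θ - δ • unitVec θ) (w + 2 * δ) δ where
  supp θ φ := by
    have := h.le θ φ
    simp only [ncoord_sub, ncoord_smul, ncoord_unitVec, sub_self, cos_zero]
    linarith
  add_pi θ := by
    simp only [h.add_pi, unitVec_add_pi]
    module
  continuous := by
    have hu : Continuous unitVec := by
      refine (PiLp.continuous_toLp 2 _).comp (continuous_pi fun i => ?_)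
      fin_cases i
      · exact continuous_cos
      · exact continuous_sin
    exact h.continuous.sub (hu.const_smul δ)
  nonneg := hδ
  width_nonneg := by linarith [h.width_nonneg]

/-- The triangle inequality: the pseudodistance between a body of constant width and a "middle
line" of three points of the body is at most the width. -/
theorem integral_medianGap_le (h : SupportCurve p w ε) {a b c : Plane}
    (ha : a ∈ supportBody p) (hb : b ∈ supportBody p) (hc : c ∈ supportBody p) :
    ∫ θ in (0 : ℝ)..π, |medianGap p a b c θ| ≤ w := by
  -- The parallel body at distance e/2 has width w + e and the same normal lines, so the gaps are
  -- unchanged.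
  refine le_of_forall_pos_le_add fun e he => ?_
  have h' := h.parallel (half_pos he).le
  have hsub : ∀ z ∈ supportBody p, z ∈ supportBody (fun θ => p θ - (e / 2) • unitVec θ) := by
    intro z hz θ
    simp only [ncoord_sub, ncoord_smul, ncoord_unitVec, sub_self, cos_zero]
    linarith [hz θ]
  have key := h'.integral_medianGap_le_of_pos (half_pos he) (hsub a ha) (hsub b hb) (hsub c hc)
  have e1 : ∀ θ, medianGap (fun θ => p θ - (e / 2) • unitVec θ) a b c θ = medianGap p a b c θ := by
    intro θ
    simp [medianGap, tcoord_sub, tcoord_smul, tcoord_unitVec]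
  simp only [e1] at key
  linarith

end SupportCurve

/-! ### Removing points one at a time -/

/-- Among finitely many points in convex position, at least three, every one sees the others in a
cone spanned by two of them. -/
lemma exists_cone_of_convex_position {ι : Type*} [DecidableEq ι] (x : ι → Plane) {s : Finset ι}
    (hs : 3 ≤ s.card) (hpos : ∀ i ∈ s, x i ∉ convexHull ℝ (x '' (s.erase i : Finset ι))) :
    ∃ i ∈ s, ∃ j ∈ s.erase i, ∃ k ∈ s.erase i, ∀ l ∈ s.erase i, ∃ σ τ : ℝ, 0 ≤ σ ∧ 0 ≤ τ ∧
      1 ≤ σ + τ ∧ x l - x i = σ • (x j - x i) + τ • (x k - x i) := by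
  obtain ⟨i, hi⟩ : s.Nonempty := Finset.card_pos.1 (by omega)
  have hcard : 2 ≤ (s.erase i).card := by rw [Finset.card_erase_of_mem hi]; omega
  obtain ⟨i₁, hi₁, i₂, hi₂, h12⟩ := Finset.one_lt_card.1 (by omega : 1 < (s.erase i).card)
  have hcl : IsClosed (convexHull ℝ (x '' (s.erase i : Finset ι))) :=
    (((s.erase i).finite_toSet.image x).isCompact_convexHull ℝ).isClosed
  -- Strict separation gives a direction u_α in which all other points are ahead of x i, so the
  -- slopes T / N order them by angle.
  obtain ⟨f, u, hfu, hf⟩ :=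
    geometric_hahn_banach_point_closed (convex_convexHull ℝ _) hcl (hpos i hi)
  set v := (InnerProductSpace.toDual ℝ Plane).symm f with hv
  have hfv : ∀ z, f z = inner ℝ v z := fun z => by rw [hv, InnerProductSpace.toDual_symm_apply]
  have hlt : ∀ l ∈ s.erase i, 0 < inner ℝ v (x l - x i) := fun l hl => by
    rw [inner_sub_right, ← hfv, ← hfv]
    linarith [hf (x l) (subset_convexHull ℝ _ ⟨l, hl, rfl⟩)]
  have hv0 : v ≠ 0 := fun h0 => by
    have := hlt i₁ hi₁
    rw [h0, inner_zero_left] at this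
    exact lt_irrefl _ this
  obtain ⟨r, α, hr, -, -, hvα⟩ := exists_polar v hv0 0
  set N : ι → ℝ := fun l => ncoord α (x l - x i) with hN
  set T : ι → ℝ := fun l => tcoord α (x l - x i) with hT
  have hNpos : ∀ l ∈ s.erase i, 0 < N l := fun l hl => by
    have := hlt l hl
    rw [hvα, inner_smul_left, inner_unitVec] at this
    exact pos_of_mul_pos_right this hr.le
  have hin : ∀ l ∈ s, ∀ l' ∈ s, l' ≠ l → x l' ∈ convexHull ℝ (x '' (s.erase l : Finset ι)) :=
    fun l _ l' hl' hne =>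
      subset_convexHull ℝ _ ⟨l', Finset.mem_coe.2 (Finset.mem_erase.2 ⟨hne, hl'⟩), rfl⟩
  -- With equal slopes, the nearer point would lie between x i and the farther one.
  have hslope : ∀ l ∈ s.erase i, ∀ l' ∈ s.erase i, l ≠ l' → N l ≤ N l' →
      T l / N l ≠ T l' / N l' := by
    intro l hl l' hl' hne hle heq
    have n1 := hNpos l hl
    have n2 := hNpos l' hl'
    have e : x l - x i = (N l / N l') • (x l' - x i) := by
      refine eq_of_coord_eq (θ := α) ?_ ?_
      · rw [ncoord_smul]; simp only [hN] at n2 ⊢; field_simp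
      · rw [tcoord_smul]
        change T l = N l / N l' * T l'
        rw [div_eq_div_iff n1.ne' n2.ne'] at heq
        field_simp
        linarith
    obtain ⟨hl1, hl2⟩ := Finset.mem_erase.1 hl
    obtain ⟨hl1', hl2'⟩ := Finset.mem_erase.1 hl'
    refine hpos l hl2 ?_
    have hx : x l = x i + (N l / N l') • (x l' - x i) := by rw [← e]; abel
    rw [hx]
    exact (convex_convexHull ℝ _).add_smul_sub_mem (hin l hl2 i hi (Ne.symm hl1))
      (hin l hl2 l' hl2' (Ne.symm hne)) ⟨by positivity, (div_le_one n2).2 hle⟩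
  have hslope' : ∀ l ∈ s.erase i, ∀ l' ∈ s.erase i, l ≠ l' → T l / N l ≠ T l' / N l' := by
    intro l hl l' hl' hne
    rcases le_total (N l) (N l') with h | h
    · exact hslope l hl l' hl' hne h
    · exact (hslope l' hl' l hl hne.symm h).symm
  obtain ⟨j, hj, hjmin⟩ := (s.erase i).exists_min_image (fun l => T l / N l) ⟨i₁, hi₁⟩
  obtain ⟨k, hk, hkmax⟩ := (s.erase i).exists_max_image (fun l => T l / N l) ⟨i₁, hi₁⟩
  refine ⟨i, hi, j, hj, k, hk, fun l hl => ?_⟩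
  rcases eq_or_ne l j with rfl | hlj
  · exact ⟨1, 0, one_pos.le, le_rfl, by simp, by simp⟩
  rcases eq_or_ne l k with rfl | hlk
  · exact ⟨0, 1, le_rfl, one_pos.le, by simp, by simp⟩
  have s1 := lt_of_le_of_ne (hjmin l hl) (hslope' j hj l hl hlj.symm)
  have s2 := lt_of_le_of_ne (hkmax l hl) (hslope' l hl k hk hlk)
  have nj := hNpos j hj
  have nk := hNpos k hk
  have nl := hNpos l hl
  set a := T j / N j with ha
  set b := T k / N k with hb
  set c := T l / N l with hc
  have ea : T j = a * N j := (div_mul_cancel₀ _ nj.ne').symm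
  have eb : T k = b * N k := (div_mul_cancel₀ _ nk.ne').symm
  have ec : T l = c * N l := (div_mul_cancel₀ _ nl.ne').symm
  have hba : 0 < b - a := by linarith
  have hbc : 0 < b - c := by linarith
  have hca : 0 < c - a := by linarith
  have hcone : x l - x i = (N l * (b - c) / (N j * (b - a))) • (x j - x i) +
      (N l * (c - a) / (N k * (b - a))) • (x k - x i) := by
    refine eq_of_coord_eq (θ := α) ?_ ?_
    · rw [ncoord_add, ncoord_smul, ncoord_smul]
      change N l = _ * N j + _ * N k
      field_simp; ring
    · rw [tcoord_add, tcoord_smul, tcoord_smul]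
      change T l = _ * T j + _ * T k
      rw [ea, eb, ec]
      field_simp; ring
  refine ⟨_, _, by positivity, by positivity, ?_, hcone⟩
  set σ := N l * (b - c) / (N j * (b - a)) with hσ
  set τ := N l * (c - a) / (N k * (b - a)) with hτ
  have σ0 : 0 ≤ σ := by positivity
  have τ0 : 0 ≤ τ := by positivity
  -- With σ + τ < 1 the point x l would lie in the triangle of x i, x j, x k.
  by_contra! hlt1
  have hl2 := Finset.mem_of_mem_erase hl
  refine hpos l hl2 ?_
  have hx : x l = (1 - σ - τ) • x i + σ • x j + τ • x k := by
    calc x l = x i + (x l - x i) := by abel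
      _ = _ := by rw [hcone]; module
  rw [hx]
  have c1 := hin l hl2 i hi (Finset.ne_of_mem_erase hl).symm
  have c2 := hin l hl2 j (Finset.mem_of_mem_erase hj) hlj.symm
  have c3 := hin l hl2 k (Finset.mem_of_mem_erase hk) hlk.symm
  have := (convex_convexHull ℝ (x '' (s.erase l : Finset ι))).sum_mem (t := Finset.univ)
    (w := ![1 - σ - τ, σ, τ]) (z := ![x i, x j, x k])
    (by intro n _; fin_cases n <;> simp <;> linarith) (by simp [Fin.sum_univ_three]; ring)
    (by intro n _; fin_cases n <;> assumption)
  simpa [Fin.sum_univ_three] using this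

/-- Removing a number between the least and the largest one. -/
lemma abs_sub_removal_of_mem {q t M m : ℝ} (h1 : m ≤ t) (h2 : t ≤ M) :
    |q - t| - |q - max t M| - |q - min t m| ≤ -|q - M| - |q - m| + |q - t| := by
  rw [max_eq_right h2, min_eq_right h1]; linarith

/-- Removing a number whose position relative to the others is determined by two of them. -/
lemma abs_sub_removal_of_median {q t M m a b : ℝ} (ha : a ≤ M) (hb : b ≤ M) (ha' : m ≤ a)
    (hb' : m ≤ b) (h1 : a ≤ t → b ≤ t → M ≤ max a b) (h2 : t ≤ a → t ≤ b → min a b ≤ m) :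
    |q - t| - |q - max t M| - |q - min t m| ≤ -|q - M| - |q - m| + |q - median t a b| := by
  unfold median
  rcases le_total a t with h3 | h3 <;> rcases le_total b t with h4 | h4
  · have e : M = max a b := le_antisymm (h1 h3 h4) (max_le ha hb)
    have e1 : M ≤ t := e ▸ max_le h3 h4
    rw [max_eq_left e1, min_eq_right (ha'.trans h3), min_eq_right h3, max_eq_left h3,
      min_eq_right h4, ← e]
    linarith
  · rw [max_eq_right (h4.trans hb), min_eq_right (ha'.trans h3), min_eq_right h3, max_eq_left h3,
      min_eq_left h4, max_eq_right h3]
    linarith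
  · rw [max_eq_right (h3.trans ha), min_eq_right (hb'.trans h4), min_eq_left h3, max_eq_right h3,
      min_eq_right (h4.trans h3), max_eq_left h4]
    linarith
  · have e : m = min a b := le_antisymm (le_min ha' hb') (h2 h3 h4)
    have e1 : t ≤ m := e ▸ le_min h3 h4
    rw [max_eq_right (h3.trans ha), min_eq_left e1, min_eq_left h3, max_eq_right h3,
      max_eq_right (le_min h3 h4), ← e]
    linarith

/-- The integrand of the inequality for finitely many points: the distances from the lines through
the points to the normal line, minus those of the two outermost lines. -/
noncomputable def polygonGap {ι : Type*} (p : ℝ → Plane) (x : ι → Plane) (s : Finset ι)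
    (hs : s.Nonempty) (θ : ℝ) : ℝ :=
  (∑ i ∈ s, |tcoord θ (p θ) - tcoord θ (x i)|) -
    |tcoord θ (p θ) - s.sup' hs fun i => tcoord θ (x i)| -
    |tcoord θ (p θ) - s.inf' hs fun i => tcoord θ (x i)|

namespace SupportCurve

variable {p : ℝ → Plane} {w ε : ℝ} (h : SupportCurve p w ε)
include h

/-- The inequality for finitely many points of a body of constant width, with the integrals over
half a turn. -/
theorem integral_polygon_le {ι : Type*} [DecidableEq ι] (x : ι → Plane) (n : ℕ) (s : Finset ι)
    (hs : s.Nonempty) (hcard : s.card = n + 2) (hmem : ∀ i ∈ s, x i ∈ supportBody p) :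
    ∫ θ in (0 : ℝ)..π, polygonGap p x s hs θ ≤ n * w := by
  have hq : Continuous fun θ => tcoord θ (p θ) := continuous_tcoord_comp continuous_id h.continuous
  have ht : ∀ z, Continuous fun θ => tcoord θ z := fun z =>
    continuous_tcoord_comp continuous_id continuous_const
  have hcont : ∀ (s : Finset ι) (hs : s.Nonempty), Continuous (polygonGap p x s hs) := by
    intro s hs
    have h1 : Continuous fun θ => s.sup' hs fun i => tcoord θ (x i) :=
      Continuous.finset_sup'_apply hs fun i _ => ht (x i)
    have h2 : Continuous fun θ => s.inf' hs fun i => tcoord θ (x i) :=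
      Continuous.finset_inf'_apply hs fun i _ => ht (x i)
    exact ((continuous_finsetSum s fun i _ => (hq.sub (ht (x i))).abs).sub (hq.sub h1).abs).sub
      (hq.sub h2).abs
  induction n generalizing s with
  | zero =>
    obtain ⟨i, j, hij, rfl⟩ := Finset.card_eq_two.1 hcard
    have e : ∀ θ, polygonGap p x {i, j} hs θ = 0 := by
      intro θ
      rw [polygonGap, Finset.sum_pair hij, Finset.sup'_insert (Finset.singleton_nonempty j),
        Finset.inf'_insert (Finset.singleton_nonempty j), Finset.sup'_singleton,
        Finset.inf'_singleton]
      rcases le_total (tcoord θ (x i)) (tcoord θ (x j)) with h1 | h1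
      · rw [sup_eq_right.2 h1, inf_eq_left.2 h1]; ring
      · rw [sup_eq_left.2 h1, inf_eq_right.2 h1]; ring
    simp only [e]
    simp
  | succ n ih =>
    -- Common to both cases: a removal whose pointwise cost is |c|, with integral at most w.
    have step : ∀ i ∈ s, ∀ (hs' : (s.erase i).Nonempty) (c : ℝ → ℝ), Continuous c →
        (∫ θ in (0 : ℝ)..π, |c θ| ≤ w) →
        (∀ θ, |tcoord θ (p θ) - tcoord θ (x i)| -
          |tcoord θ (p θ) - max (tcoord θ (x i)) ((s.erase i).sup' hs' fun i => tcoord θ (x i))| -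
          |tcoord θ (p θ) - min (tcoord θ (x i)) ((s.erase i).inf' hs' fun i => tcoord θ (x i))| ≤
          -|tcoord θ (p θ) - (s.erase i).sup' hs' fun i => tcoord θ (x i)| -
          |tcoord θ (p θ) - (s.erase i).inf' hs' fun i => tcoord θ (x i)| + |c θ|) →
        ∫ θ in (0 : ℝ)..π, polygonGap p x s hs θ ≤ (n + 1 : ℕ) * w := by
      intro i hi hs' c hc hcw hpt
      have key := ih (s.erase i) hs' (by rw [Finset.card_erase_of_mem hi]; omega)
        fun l hl => hmem l (Finset.mem_of_mem_erase hl)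
      have hle : ∀ θ, polygonGap p x s hs θ ≤
          polygonGap p x (s.erase i) hs' θ + |c θ| := by
        intro θ
        have e1 : s.sup' hs (fun i => tcoord θ (x i)) =
            max (tcoord θ (x i)) ((s.erase i).sup' hs' fun i => tcoord θ (x i)) := by
          rw [← Finset.sup'_insert hs' (f := fun i => tcoord θ (x i))]
          exact Finset.sup'_congr _ (Finset.insert_erase hi).symm fun _ _ => rfl
        have e2 : s.inf' hs (fun i => tcoord θ (x i)) =
            min (tcoord θ (x i)) ((s.erase i).inf' hs' fun i => tcoord θ (x i)) := by
          rw [← Finset.inf'_insert hs' (f := fun i => tcoord θ (x i))]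
          exact Finset.inf'_congr _ (Finset.insert_erase hi).symm fun _ _ => rfl
        rw [polygonGap, polygonGap, e1, e2, ← Finset.add_sum_erase s _ hi]
        linarith [hpt θ]
      have := intervalIntegral.integral_mono_on (μ := MeasureTheory.volume) pi_pos.le
        ((hcont s hs).intervalIntegrable 0 π)
        (((hcont _ hs').intervalIntegrable 0 π).add (hc.abs.intervalIntegrable 0 π))
        fun θ _ => hle θ
      rw [intervalIntegral.integral_add ((hcont _ hs').intervalIntegrable 0 π)
        (hc.abs.intervalIntegrable 0 π)] at this
      push_cast
      linarith
    have hne : ∀ i ∈ s, (s.erase i).Nonempty := fun i hi =>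
      Finset.card_pos.1 (by rw [Finset.card_erase_of_mem hi]; omega)
    by_cases hpos : ∀ i ∈ s, x i ∉ convexHull ℝ (x '' (s.erase i : Finset ι))
    · obtain ⟨i, hi, j, hj, k, hk, hcone⟩ := exists_cone_of_convex_position x (by omega) hpos
      refine step i hi (hne i hi) (medianGap p (x i) (x j) (x k)) (h.continuous_medianGap _ _ _)
        (h.integral_medianGap_le (hmem i hi) (hmem j (Finset.mem_of_mem_erase hj))
          (hmem k (Finset.mem_of_mem_erase hk))) fun θ => ?_
      have hcone' : ∀ l ∈ s.erase i, ∃ σ τ : ℝ, 0 ≤ σ ∧ 0 ≤ τ ∧ 1 ≤ σ + τ ∧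
          tcoord θ (x l) - tcoord θ (x i) = σ * (tcoord θ (x j) - tcoord θ (x i)) +
            τ * (tcoord θ (x k) - tcoord θ (x i)) := by
        intro l hl
        obtain ⟨σ, τ, hσ, hτ, hστ, e⟩ := hcone l hl
        refine ⟨σ, τ, hσ, hτ, hστ, ?_⟩
        rw [← tcoord_sub, e, tcoord_add, tcoord_smul, tcoord_smul, tcoord_sub, tcoord_sub]
      refine abs_sub_removal_of_median (Finset.le_sup' (fun i => tcoord θ (x i)) hj)
        (Finset.le_sup' (fun i => tcoord θ (x i)) hk)
        (Finset.inf'_le (fun i => tcoord θ (x i)) hj)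
        (Finset.inf'_le (fun i => tcoord θ (x i)) hk) (fun h1 h2 => ?_) fun h1 h2 => ?_
      -- Both generators point weakly downwards and σ + τ ≥ 1, so x l is at least as far below x i
      -- as the higher of x j and x k.
      · refine Finset.sup'_le _ _ fun l hl => ?_
        obtain ⟨σ, τ, hσ, hτ, hστ, e⟩ := hcone' l hl
        have m1 := le_max_left (tcoord θ (x j)) (tcoord θ (x k))
        have m2 := le_max_right (tcoord θ (x j)) (tcoord θ (x k))
        have m3 := max_le h1 h2
        nlinarith [mul_le_mul_of_nonneg_left m1 hσ, mul_le_mul_of_nonneg_left m2 hτ,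
          mul_nonneg (sub_nonneg.2 hστ) (sub_nonneg.2 m3)]
      · refine Finset.le_inf' _ _ fun l hl => ?_
        obtain ⟨σ, τ, hσ, hτ, hστ, e⟩ := hcone' l hl
        have m1 := min_le_left (tcoord θ (x j)) (tcoord θ (x k))
        have m2 := min_le_right (tcoord θ (x j)) (tcoord θ (x k))
        have m3 := le_min h1 h2
        nlinarith [mul_le_mul_of_nonneg_left m1 hσ, mul_le_mul_of_nonneg_left m2 hτ,
          mul_nonneg (sub_nonneg.2 hστ) (sub_nonneg.2 m3)]
    -- Coinciding points also end up here.
    · push Not at hpos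
      obtain ⟨i, hi, hconv⟩ := hpos
      refine step i hi (hne i hi) (normalGap p (x i)) (h.continuous_normalGap _)
        (by simpa using h.integral_abs_normalGap_le (hmem i hi) 0) fun θ => ?_
      refine abs_sub_removal_of_mem ?_ ?_
      · have hc := convex_halfSpace_ge (isLinearMap_tcoord θ)
          ((s.erase i).inf' (hne i hi) fun i => tcoord θ (x i))
        refine convexHull_min ?_ hc hconv
        rintro _ ⟨l, hl, rfl⟩
        exact Finset.inf'_le (fun i => tcoord θ (x i)) hl
      · have hc := convex_halfSpace_le (isLinearMap_tcoord θ)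
          ((s.erase i).sup' (hne i hi) fun i => tcoord θ (x i))
        refine convexHull_min ?_ hc hconv
        rintro _ ⟨l, hl, rfl⟩
        exact Finset.le_sup' (fun i => tcoord θ (x i)) hl

end SupportCurve

/-! ### Normal lines and supporting lines -/

lemma mem_supportPoints {C : Set Plane} {θ : ℝ} {x : Plane} :
    x ∈ supportPoints C θ ↔ x ∈ C ∧ ∀ y ∈ C, ncoord θ x ≤ ncoord θ y := by
  simp only [supportPoints, Set.mem_ofPred_eq, inner_unitVec]

lemma normalLine_eq {C : Set Plane} {θ : ℝ} {x : Plane} (hx : supportPoints C θ = {x}) :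
    normalLine C θ = {y | tcoord θ y = tcoord θ x} := by
  ext y
  simp only [normalLine, hx, Set.mem_singleton_iff, exists_eq_left, Set.mem_ofPred_eq]
  constructor
  · rintro ⟨t, rfl⟩
    simp [tcoord_add, tcoord_smul, tcoord_unitVec]
  · intro hy
    refine ⟨ncoord θ y - ncoord θ x, eq_of_coord_eq (θ := θ) ?_ ?_⟩
    · simp [ncoord_add, ncoord_smul, ncoord_unitVec]
    · simp [tcoord_add, tcoord_smul, tcoord_unitVec, hy]

lemma supportPoints_singleton (a : Plane) (θ : ℝ) : supportPoints {a} θ = {a} := by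
  ext y
  simp only [mem_supportPoints, Set.mem_singleton_iff, forall_eq]
  exact ⟨fun h => h.1, fun h => ⟨h, by rw [h]⟩⟩

lemma lineDist_eq (θ s t : ℝ) :
    lineDist {y | tcoord θ y = s} {y | tcoord θ y = t} = |s - t| := by
  have h1 : ncoord θ (tangentVec θ) = 0 := by simp [ncoord_tangentVec]
  have h2 : tcoord θ (tangentVec θ) = 1 := by
    simp [tcoord, tangentVec, ← sq, sin_sq_add_cos_sq]
  refine IsLeast.csInf_eq ⟨⟨s • tangentVec θ, by simp [tcoord_smul, h2], t • tangentVec θ,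
    by simp [tcoord_smul, h2], ?_⟩, ?_⟩
  · have h3 := ncoord_sq_add_tcoord_sq θ (tangentVec θ)
    rw [h1, h2] at h3
    have h4 : ‖tangentVec θ‖ = 1 := by
      rw [← pow_left_inj₀ (norm_nonneg _) zero_le_one two_ne_zero]; linarith
    rw [dist_eq_norm, ← sub_smul, norm_smul, h4, mul_one, norm_eq_abs]
  · rintro _ ⟨x, hx, y, hy, rfl⟩
    rw [Set.mem_ofPred_eq] at hx hy
    rw [← hx, ← hy, ← tcoord_sub, dist_eq_norm]
    exact abs_tcoord_le θ _

lemma rightSupportLine_convexHull {ι : Type*} [Fintype ι] (x : ι → Plane)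
    (hne : (Finset.univ : Finset ι).Nonempty) (θ : ℝ) :
    rightSupportLine (convexHull ℝ (Set.range x)) θ =
      {y | tcoord θ y = Finset.univ.sup' hne fun i => tcoord θ (x i)} := by
  have : sSup ((fun y => tcoord θ y) '' convexHull ℝ (Set.range x)) =
      Finset.univ.sup' hne fun i => tcoord θ (x i) := by
    refine IsGreatest.csSup_eq ⟨?_, ?_⟩
    · obtain ⟨i, -, hi⟩ := Finset.exists_mem_eq_sup' hne fun i => tcoord θ (x i)
      exact ⟨x i, subset_convexHull ℝ _ ⟨i, rfl⟩, hi.symm⟩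
    · rintro _ ⟨y, hy, rfl⟩
      refine convexHull_min ?_ (convex_halfSpace_le (isLinearMap_tcoord θ)
        (Finset.univ.sup' hne fun i => tcoord θ (x i))) hy
      rintro _ ⟨i, rfl⟩
      exact Finset.le_sup' (fun i => tcoord θ (x i)) (Finset.mem_univ i)
  simp only [rightSupportLine, inner_tangentVec, this]

lemma leftSupportLine_convexHull {ι : Type*} [Fintype ι] (x : ι → Plane)
    (hne : (Finset.univ : Finset ι).Nonempty) (θ : ℝ) :
    leftSupportLine (convexHull ℝ (Set.range x)) θ =
      {y | tcoord θ y = Finset.univ.inf' hne fun i => tcoord θ (x i)} := by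
  have : sInf ((fun y => tcoord θ y) '' convexHull ℝ (Set.range x)) =
      Finset.univ.inf' hne fun i => tcoord θ (x i) := by
    refine IsLeast.csInf_eq ⟨?_, ?_⟩
    · obtain ⟨i, -, hi⟩ := Finset.exists_mem_eq_inf' hne fun i => tcoord θ (x i)
      exact ⟨x i, subset_convexHull ℝ _ ⟨i, rfl⟩, hi.symm⟩
    · rintro _ ⟨y, hy, rfl⟩
      refine convexHull_min ?_ (convex_halfSpace_ge (isLinearMap_tcoord θ)
        (Finset.univ.inf' hne fun i => tcoord θ (x i))) hy
      rintro _ ⟨i, rfl⟩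
      exact Finset.inf'_le (fun i => tcoord θ (x i)) (Finset.mem_univ i)
  simp only [leftSupportLine, inner_tangentVec, this]

/-- The support points of a body of constant width form a `SupportCurve`. -/
lemma IsConstantWidthBody.exists_supportCurve {D : Set Plane} (hD : IsConstantWidthBody D) :
    ∃ p w, SupportCurve p w 0 ∧ (∀ θ, supportPoints D θ = {p θ}) := by
  obtain ⟨w, hw⟩ := hD.constWidth
  have hex : ∀ θ, ∃ x ∈ D, ∀ y ∈ D, ncoord θ x ≤ ncoord θ y := fun θ =>
    hD.isCompact.exists_isMinOn hD.nonempty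
      (continuous_ncoord_comp continuous_const continuous_id).continuousOn
  choose p hpD hp using hex
  have hpmax : ∀ θ, ∀ y ∈ D, ncoord θ y ≤ ncoord θ (p (θ + π)) := fun θ y hy => by
    have := hp (θ + π) y hy
    rw [ncoord_add_pi, ncoord_add_pi] at this
    linarith
  have hwidth : ∀ θ, ncoord θ (p (θ + π)) - ncoord θ (p θ) = w := by
    intro θ
    rw [← hw (unitVec θ) (norm_unitVec θ), widthIn]
    simp only [inner_unitVec]
    congr 1
    · refine (IsGreatest.csSup_eq (s := ncoord θ '' D) (a := ncoord θ (p (θ + π)))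
        ⟨⟨_, hpD _, rfl⟩, ?_⟩).symm
      rintro _ ⟨y, hy, rfl⟩
      exact hpmax θ y hy
    · refine (IsLeast.csInf_eq (s := ncoord θ '' D) (a := ncoord θ (p θ))
        ⟨⟨_, hpD _, rfl⟩, ?_⟩).symm
      rintro _ ⟨y, hy, rfl⟩
      exact hp θ y hy
  have hw0 : 0 ≤ w := by rw [← hwidth 0]; linarith [hp 0 _ (hpD (0 + π))]
  have hnorm : ∀ x ∈ D, ∀ y ∈ D, ‖x - y‖ ≤ w := by
    intro x hx y hy
    rcases eq_or_ne (x - y) 0 with h0 | h0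
    · rw [h0, norm_zero]; exact hw0
    · obtain ⟨r, θ, hr, -, -, e⟩ := exists_polar _ h0 0
      have h1 : ncoord θ (x - y) = r := by rw [e, ncoord_smul, ncoord_unitVec]; simp
      rw [e, norm_smul, norm_unitVec, mul_one, norm_eq_abs, abs_of_pos hr, ← h1, ncoord_sub,
        ← hwidth θ]
      linarith [hpmax θ x hx, hp θ y hy]
  have hopp : ∀ θ, ∀ x ∈ D, ncoord θ x = ncoord θ (p θ) → p (θ + π) = x + w • unitVec θ := by
    intro θ x hx h0
    have h1 := hnorm _ (hpD (θ + π)) x hx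
    have h2 := ncoord_sq_add_tcoord_sq θ (p (θ + π) - x)
    rw [ncoord_sub, h0, hwidth] at h2
    have h3 : tcoord θ (p (θ + π) - x) = 0 := by
      refine pow_eq_zero_iff two_ne_zero |>.1 (le_antisymm ?_ (sq_nonneg _))
      nlinarith [norm_nonneg (p (θ + π) - x)]
    rw [tcoord_sub] at h3
    refine eq_of_coord_eq (θ := θ) ?_ ?_
    · rw [ncoord_add, ncoord_smul, ncoord_unitVec, sub_self, cos_zero]; linarith [hwidth θ]
    · rw [tcoord_add, tcoord_smul, tcoord_unitVec, sub_self, sin_zero]; linarith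
  -- Since `p (θ + π)` is within w of `p φ`, the square ‖p θ - p φ‖² is at most 2w times the support
  -- distance of `p φ` at θ, which is at most ‖p θ - p φ‖ |θ - φ|.
  have hlip : ∀ θ φ, dist (p θ) (p φ) ≤ (2 * w) * dist θ φ := by
    intro θ φ
    have h1 := hp θ _ (hpD φ)
    have h2 := hp φ _ (hpD θ)
    have h3 := (abs_le.1 (abs_ncoord_sub_le θ φ (p θ - p φ))).1
    have h4 := ncoord_sq_add_tcoord_sq θ (p θ - p φ)
    have h5 := ncoord_sq_add_tcoord_sq θ (p (θ + π) - p φ)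
    have h6 := pow_le_pow_left₀ (norm_nonneg _) (hnorm _ (hpD (θ + π)) _ (hpD φ)) 2
    rw [← h5, hopp θ _ (hpD θ) rfl] at h6
    simp only [ncoord_sub, ncoord_add, ncoord_smul, ncoord_unitVec, tcoord_sub, tcoord_add,
      tcoord_smul, tcoord_unitVec, sub_self, sin_zero, cos_zero] at h3 h4 h6
    rw [dist_eq_norm, dist_eq_norm, norm_eq_abs]
    rcases (norm_nonneg (p θ - p φ)).eq_or_lt with h0 | h0
    · rw [← h0]; positivity
    · refine le_of_mul_le_mul_left ?_ h0
      nlinarith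
  refine ⟨p, w, ⟨fun θ φ => ?_, fun θ => hopp θ _ (hpD θ) rfl,
    (LipschitzWith.of_dist_le' hlip).continuous, le_rfl, hw0⟩, fun θ => ?_⟩
  · rw [zero_mul]; exact sub_nonneg.2 (hp θ _ (hpD φ))
  · ext x
    rw [mem_supportPoints, Set.mem_singleton_iff]
    refine ⟨fun ⟨hx, hmin⟩ => ?_, ?_⟩
    · have h1 := hopp θ x hx (le_antisymm (hmin _ (hpD θ)) (hp θ x hx))
      rw [hopp θ _ (hpD θ) rfl] at h1
      exact (add_right_cancel h1).symm
    · rintro rfl; exact ⟨hpD θ, hp θ⟩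

/-! ### Passage to half a turn and conclusion -/

lemma half_integral_of_periodic {f : ℝ → ℝ} (hf : Continuous f) (hper : Function.Periodic f π) :
    (1 / 2) * ∫ θ in (0 : ℝ)..2 * π, f θ = ∫ θ in (0 : ℝ)..π, f θ := by
  have h1 := hper.intervalIntegral_add_eq π 0
  rw [zero_add, ← two_mul] at h1
  rw [← intervalIntegral.integral_add_adjacent_intervals (hf.intervalIntegrable 0 π)
    (hf.intervalIntegrable π (2 * π)), h1]
  ring

lemma sup'_neg_eq {ι : Type*} {s : Finset ι} (hs : s.Nonempty) (f : ι → ℝ) :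
    (s.sup' hs fun i => -f i) = -s.inf' hs f := by
  refine le_antisymm (Finset.sup'_le _ _ fun i hi => neg_le_neg (Finset.inf'_le f hi)) ?_
  obtain ⟨i, hi, e⟩ := Finset.exists_mem_eq_inf' hs f
  rw [e]
  exact Finset.le_sup' (fun i => -f i) hi

lemma inf'_neg_eq {ι : Type*} {s : Finset ι} (hs : s.Nonempty) (f : ι → ℝ) :
    (s.inf' hs fun i => -f i) = -s.sup' hs f := by
  have := sup'_neg_eq hs fun i => -f i
  simp only [neg_neg] at this
  rw [this, neg_neg]

theorem mainTheorem3 (D P : Set Plane) (m : ℕ) (a : Fin m → Plane)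
    (hD : IsConstantWidthBody D) (hP : IsConvexPolygon P a) (hPD : P ⊆ D) :
    ∑ i, pdist {a i} D ≤ pper D P + ((m : ℝ) - 2) * Metric.diam D := by
  obtain ⟨p, w, h, hsupp⟩ := hD.exists_supportCurve
  have hm := hP.three_le
  have hpD : ∀ θ, p θ ∈ D ∧ ∀ y ∈ D, ncoord θ (p θ) ≤ ncoord θ y := fun θ =>
    mem_supportPoints.1 (by rw [hsupp]; rfl)
  have hmem : ∀ i, a i ∈ supportBody p := fun i θ =>
    (hpD θ).2 _ (hPD (by rw [hP.eq_convexHull]; exact subset_convexHull ℝ _ ⟨i, rfl⟩))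
  have hdiam : w ≤ Metric.diam D := by
    have := Metric.dist_le_diam_of_mem hD.isCompact.isBounded (hpD (0 + π)).1 (hpD 0).1
    rw [h.add_pi, dist_eq_norm, add_sub_cancel_left, norm_smul, norm_unitVec, mul_one,
      Real.norm_eq_abs] at this
    exact (le_abs_self w).trans this
  have hne : (Finset.univ : Finset (Fin m)).Nonempty := ⟨⟨0, by omega⟩, Finset.mem_univ _⟩
  have hq : Continuous fun θ => tcoord θ (p θ) := continuous_tcoord_comp continuous_id h.continuous
  have ht : ∀ z, Continuous fun θ => tcoord θ z := fun z =>
    continuous_tcoord_comp continuous_id continuous_const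
  have hpd : ∀ i, pdist {a i} D = ∫ θ in (0 : ℝ)..π, |normalGap p (a i) θ| := by
    intro i
    rw [← half_integral_of_periodic (h.continuous_normalGap _).abs (h.abs_normalGap_periodic _)]
    simp only [pdist, normalLine_eq (hsupp _), normalLine_eq (supportPoints_singleton _ _),
      lineDist_eq, normalGap, abs_sub_comm]
  set G : ℝ → ℝ := fun θ => |tcoord θ (p θ) - Finset.univ.sup' hne fun i => tcoord θ (a i)| +
    |tcoord θ (p θ) - Finset.univ.inf' hne fun i => tcoord θ (a i)| with hG
  have hGc : Continuous G :=
    (hq.sub (Continuous.finset_sup'_apply hne fun i _ => ht (a i))).abs.add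
      (hq.sub (Continuous.finset_inf'_apply hne fun i _ => ht (a i))).abs
  -- Half a turn negates tangential coordinates and so exchanges the two supporting lines.
  have hGper : Function.Periodic G π := by
    intro θ
    have := h.normalGap_add_pi 0 θ
    simp only [normalGap, tcoord_add_pi] at this
    simp only [hG, tcoord_add_pi, sup'_neg_eq, inf'_neg_eq]
    have e : tcoord θ (p (θ + π)) = tcoord θ (p θ) := by linarith
    rw [e, neg_sub_neg, neg_sub_neg, abs_sub_comm, abs_sub_comm (Finset.sup' _ _ _), add_comm]
  have hpp : pper D P = ∫ θ in (0 : ℝ)..π, G θ := by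
    rw [← half_integral_of_periodic hGc hGper]
    simp only [pper, hP.eq_convexHull, rightSupportLine_convexHull a hne,
      leftSupportLine_convexHull a hne, normalLine_eq (hsupp _), lineDist_eq, hG, abs_sub_comm]
  -- Applied to the index set, so vertices count with multiplicity.
  have key := h.integral_polygon_le a (m - 2) Finset.univ hne
    (by rw [Finset.card_univ, Fintype.card_fin]; omega) fun i _ => hmem i
  have hcast : ((m - 2 : ℕ) : ℝ) = (m : ℝ) - 2 := by rw [Nat.cast_sub (by omega)]; norm_num
  have hsum : ∫ θ in (0 : ℝ)..π, polygonGap p a Finset.univ hne θ =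
      ∑ i, pdist {a i} D - pper D P := by
    have e : ∀ θ, polygonGap p a Finset.univ hne θ = ∑ i, |normalGap p (a i) θ| - G θ := by
      intro θ; simp only [polygonGap, hG, normalGap]; ring
    simp only [e]
    rw [intervalIntegral.integral_sub
      ((continuous_finsetSum _ fun i _ => (h.continuous_normalGap (a i)).abs).intervalIntegrable _ _)
      (hGc.intervalIntegrable _ _), intervalIntegral.integral_finsetSum fun i _ =>
        h.intervalIntegrable_abs_normalGap _ _ _, hpp]
    simp only [hpd]
  rw [hsum, hcast] at key
  have : ((m : ℝ) - 2) * w ≤ ((m : ℝ) - 2) * Metric.diam D :=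
    mul_le_mul_of_nonneg_left hdiam (by rw [← hcast]; positivity)
  linarith
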